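/- A composition of $n$ (with parts in $\mathbb{N}=\{1,2,3,\dots\}$) is a finite sequence of positive integers with sum $n$. For a three-letter pattern $\tau=\tau_1\tau_2\tau_3$, an occurrence of $\tau$ in a composition is a triple of adjacent parts whose letters are in the same relative order (with respect to $<$, $=$, $>$) as $\tau_1,\tau_2,\tau_3$. An occurrence of *peak* is an occurrence of one of $121$, $132$, $231$, and an occurrence of *valley* is an occurrence of one of $212$, $213$, $312$. Let $C_\tau(n,0)$ be the number of compositions of $n$ without any occurrence of $\tau$. Then, for each $\tau\in\{111,112,221,123,peak,valley\}$, there are real constants $K_\tau$ and $v_\tau$ such that $$C_\tau(n,0)=K_\tau\cdot v_\tau^{\,n}+O\big((10/7)^n\big)\qquad(n\to\infty),$$ and the values of these constants, rounded to six significant digits, are $$\begin{array}{lll} K_{111}\approx 0.499301, & v_{111}\approx 1.91076,\\ K_{112}\approx 0.692005, & v_{112}\approx 1.80688,\\ K_{221}\approx 0.545362, & v_{221}\approx 1.94785,\\ K_{123}\approx 0.576096, & v_{123}\approx 1.94823,\\ K_{peak}\approx 1.39456, & v_{peak}\approx 1.62975,\\ K_{valley}\approx 0.728207, & v_{valley}\approx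 1.84092. \end{array}$$ That is, each $v_\tau$ and $K_{peak}$ differs from the displayed value by less than $5\cdot 10^{-6}$, and each other $K_\tau$ by less than $5\cdot 10^{-7}$. -/

import Mathlib

open Asymptotics Filter

namespace CompPattern

/-- A three-letter word with letters in `ℕ`. -/
abbrev Word3 : Type := Fin 3 → ℕ

/-- The three letters of `w` are in the same relative order as those of the pattern `τ`
(`<`, `=` and `>` between any two positions agree). -/
def SameOrder (τ w : Word3) : Prop := ∀ i j : Fin 3, w i < w j ↔ τ i < τ j

instance (τ w : Word3) : Decidable (SameOrder τ w) :=
  inferInstanceAs (Decidable (∀ i j : Fin 3, w i < w j ↔ τ i < τ j))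

/-- The number of occurrences, in a sequence of parts, of the patterns in the set `P`: the number
of windows of three adjacent parts that are in the same relative order as some `τ ∈ P`. -/
def occurrences (P : Finset Word3) : List ℕ → ℕ
  | a :: b :: c :: l =>
      (if ∃ τ ∈ P, SameOrder τ ![a, b, c] then 1 else 0) + occurrences P (b :: c :: l)
  | _ => 0

/-- The number of compositions of `n` with parts in `{1, 2, 3, …}` that contain
(patterns from) `P` exactly `r` times. -/
def compCount (P : Finset Word3) (n r : ℕ) : ℕ :=
  (Finset.univ.filter fun c : Composition n => occurrences P c.blocks = r).card

/-- level + level -/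
def pat111 : Finset Word3 := {![1, 1, 1]}

/-- level + rise -/
def pat112 : Finset Word3 := {![1, 1, 2]}

/-- level + drop -/
def pat221 : Finset Word3 := {![2, 2, 1]}

/-- rise + rise -/
def pat123 : Finset Word3 := {![1, 2, 3]}

/-- rise + drop -/
def peak : Finset Word3 := {![1, 2, 1], ![1, 3, 2], ![2, 3, 1]}

/-- drop + rise -/
def valley : Finset Word3 := {![2, 1, 2], ![2, 1, 3], ![3, 1, 2]}

end CompPattern

/-!
Each of the six patterns forbids a step `a R b` directly followed by a step `b S c`, where `R` and
`S` are among `<`, `=`, `>`. Let `C` be the generating function of the compositions that avoid the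
pattern.

*Generating function.* Over the alphabet `{1, …, m}`, let `X_a` count the words `w` for which `a w`
avoids the pattern. Splitting by the first letters gives linear equations between the `X_a` and `C`
(`IsStepPattern.afterGF_add_sum`, `IsStepPattern.stepGF_of_disjoint`,
`IsStepPattern.stepGF_of_eq`). Because `R` and `S` only compare letters, partial sums over the
letters satisfy recursions of bounded size, and eliminating the letters one at a time yields
`D C = N` with `D` and `N` given by explicit recursions (`den111_mul`, …, `zigzag_valley_mul`).
The step for the letter `m` changes `D` and `N` in degrees `≥ m` only, so the identities survive the
limit `m → ∞` (`IsStable.stableLim_mul_avoidGF`).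

*Asymptotics.* `D` has a simple root `ρ` between `0.51` and `0.62`, and `v = 1/ρ`,
`K = -N(ρ) / (ρ D'(ρ))`. To see that no other root matters up to radius `r = 7/10`, one
multiplies by a polynomial `Q` for which `Q D` is nearly linear. Then `Q D / (1 - x/ρ)` is dominated
by its constant term in the `ℓ¹` norm with weights `rⁿ`, so that `C (1 - x/ρ)` has finite norm (`WSummable.of_mul_eq`), and summation
gives `K vⁿ + O(r⁻ⁿ)` (`isBigO_of_simple_root`). No complex analysis is involved.

*Numerics.* The recursions also show that the coefficients of `D` and `N` are at most
`8200 (20/17)ⁿ` in absolute value. Hence the first hundred coefficients, which the kernel computes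
from the recursions, determine all needed quantities up to small explicit errors (`Certificate`,
`isBigO_of_certificate`).
-/

namespace CompPattern
open PowerSeries

/-! ### Words and their generating functions -/

/-- The block sequences of the compositions of `n`. -/
def words (n : ℕ) : Finset (List ℕ) := Finset.univ.image fun c : Composition n => c.blocks

theorem mem_words {n : ℕ} {l : List ℕ} : l ∈ words n ↔ (∀ b ∈ l, 0 < b) ∧ l.sum = n := by
  simp only [words, Finset.mem_image, Finset.mem_univ, true_and]
  constructor
  · rintro ⟨c, rfl⟩
    exact ⟨fun b hb => c.blocks_pos hb, c.blocks_sum⟩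
  · rintro ⟨h, hs⟩
    exact ⟨⟨l, fun {b} hb => h b hb, hs⟩, rfl⟩

theorem nil_mem_words {n : ℕ} : [] ∈ words n ↔ n = 0 := by
  rw [mem_words]; simp [eq_comm]

theorem cons_mem_words {n b : ℕ} {l : List ℕ} :
    b :: l ∈ words n ↔ 0 < b ∧ b ≤ n ∧ l ∈ words (n - b) := by
  simp only [mem_words, List.mem_cons, forall_eq_or_imp, List.sum_cons]
  constructor
  · rintro ⟨⟨h1, h2⟩, h3⟩
    exact ⟨h1, by omega, h2, by omega⟩
  · rintro ⟨h1, h2, h3, h4⟩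
    exact ⟨⟨h1, h3⟩, by omega⟩

open Classical in
/-- The generating function, by sum, of the words with letters in `{1, …, m}` that satisfy `φ`. -/
noncomputable def wordGF (m : ℕ) (φ : List ℕ → Prop) : ℤ⟦X⟧ :=
  PowerSeries.mk fun n => (((words n).filter fun l => (∀ b ∈ l, b ≤ m) ∧ φ l).card : ℤ)

theorem wordGF_congr {m : ℕ} {φ ψ : List ℕ → Prop} (h : ∀ l, φ l ↔ ψ l) :
    wordGF m φ = wordGF m ψ := by
  rw [show φ = ψ from funext fun l => propext (h l)]

theorem wordGF_split (m : ℕ) (φ ψ : List ℕ → Prop) :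
    wordGF m φ = wordGF m (fun l => φ l ∧ ψ l) + wordGF m (fun l => φ l ∧ ¬ ψ l) := by
  classical
  ext n
  simp only [wordGF, coeff_mk, map_add]
  rw [← Nat.cast_add]
  congr 1
  rw [← Finset.card_filter_add_card_filter_not (s := (words n).filter _) (p := ψ),
    Finset.filter_filter, Finset.filter_filter]
  simp only [and_assoc]

/-- First-letter decomposition: a word is empty, or a letter `b ∈ {1, …, m}` followed by a
word. -/
theorem wordGF_eq (m : ℕ) (φ : List ℕ → Prop) [Decidable (φ [])] :
    wordGF m φ = (if φ [] then 1 else 0) +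
      ∑ b ∈ Finset.Icc 1 m, X ^ b * wordGF m (fun l => φ (b :: l)) := by
  classical
  ext n
  simp only [wordGF, map_add, map_sum, coeff_X_pow_mul', coeff_mk]
  have hsplit : (words n).filter (fun l => (∀ b ∈ l, b ≤ m) ∧ φ l) =
      (if n = 0 ∧ φ [] then {[]} else ∅) ∪ (Finset.Icc 1 m).biUnion fun b =>
        if b ≤ n then ((words (n - b)).filter
          fun l => (∀ c ∈ l, c ≤ m) ∧ φ (b :: l)).image (List.cons b) else ∅ := by
    ext l
    simp only [Finset.mem_union, Finset.mem_biUnion, Finset.mem_filter, Finset.mem_Icc]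
    cases l with
    | nil =>
      rw [nil_mem_words]
      constructor
      · rintro ⟨h1, -, h2⟩
        left; simp [h1, h2]
      · rintro (h | ⟨b, -, h⟩)
        · split_ifs at h with h0
          · simpa using h0
          · simp at h
        · split_ifs at h <;> simp at h
    | cons b l =>
      rw [cons_mem_words]
      constructor
      · rintro ⟨⟨h1, h2, h3⟩, h4, h5⟩
        right
        refine ⟨b, ⟨h1, h4 b (by simp)⟩, ?_⟩
        rw [if_pos h2]
        refine Finset.mem_image_of_mem _ (Finset.mem_filter.2 ⟨h3, fun c hc => h4 c ?_, h5⟩)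
        simp [hc]
      · rintro (h | ⟨c, hc, h⟩)
        · split_ifs at h <;> simp at h
        · split_ifs at h with hcn
          · obtain ⟨l', hl', he⟩ := Finset.mem_image.1 h
            obtain ⟨rfl, rfl⟩ := List.cons.inj he
            rw [Finset.mem_filter] at hl'
            refine ⟨⟨hc.1, hcn, hl'.1⟩, ?_, hl'.2.2⟩
            intro d hd
            rcases List.mem_cons.1 hd with rfl | hd
            · exact hc.2
            · exact hl'.2.1 d hd
          · simp at h
  rw [hsplit, Finset.card_union_of_disjoint, Finset.card_biUnion]
  · push_cast
    congr 1
    · by_cases h0 : n = 0 <;> by_cases hφ : φ [] <;> simp [h0, hφ, coeff_one]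
    · refine Finset.sum_congr rfl fun b _ => ?_
      split_ifs with hb
      · rw [Finset.card_image_of_injective _ (List.cons_injective)]
      · simp
  · intro b _ c _ hbc
    rw [Function.onFun, Finset.disjoint_left]
    intro l hl hl'
    split_ifs at hl hl' <;> simp only [Finset.mem_image, Finset.notMem_empty] at hl hl'
    obtain ⟨l1, -, rfl⟩ := hl
    obtain ⟨l2, -, h⟩ := hl'
    exact hbc (List.cons.inj h).1.symm
  · rw [Finset.disjoint_left]
    intro l hl hl'
    simp only [Finset.mem_biUnion] at hl'
    obtain ⟨b, -, hl'⟩ := hl'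
    split_ifs at hl hl' <;>
      simp only [Finset.mem_image, Finset.mem_singleton, Finset.notMem_empty] at hl hl'
    subst hl
    obtain ⟨l2, -, h⟩ := hl'
    simp at h

/-- The generating function of the compositions without an occurrence of a pattern from `P`. -/
noncomputable def avoidGF (P : Finset Word3) : ℤ⟦X⟧ :=
  PowerSeries.mk fun n => (compCount P n 0 : ℤ)

theorem compCount_eq_card_words (P : Finset Word3) (n : ℕ) :
    compCount P n 0 = ((words n).filter fun l => occurrences P l = 0).card := by
  rw [compCount, words, Finset.filter_image, Finset.card_image_of_injective]
  intro c d h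
  exact Composition.ext h

/-- A composition of `n` only uses letters up to `n`. -/
theorem X_pow_dvd_avoidGF_sub (P : Finset Word3) (m : ℕ) :
    (X : ℤ⟦X⟧) ^ (m + 1) ∣ wordGF m (fun l => occurrences P l = 0) - avoidGF P := by
  classical
  rw [X_pow_dvd_iff]
  intro n hn
  simp only [wordGF, avoidGF, map_sub, coeff_mk, compCount_eq_card_words, sub_eq_zero, Nat.cast_inj]
  congr 1
  refine Finset.filter_congr fun l hl => ?_
  rw [mem_words] at hl
  refine and_iff_right fun b hb => ?_
  have := List.le_sum_of_mem hb
  omega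

/-! ### Patterns made of two steps -/

/-- `w` starts with a letter `c` such that `S b c`. -/
def HeadRel (S : ℕ → ℕ → Prop) (b : ℕ) : List ℕ → Prop
  | [] => False
  | c :: _ => S b c

/-- The occurrences of `P` are the windows `a b c` with `R a b` and `S b c`. -/
def IsStepPattern (P : Finset Word3) (R S : ℕ → ℕ → Prop) : Prop :=
  ∀ a b c, (∃ τ ∈ P, SameOrder τ ![a, b, c]) ↔ R a b ∧ S b c

theorem sameOrder_iff (x y z a b c : ℕ) : SameOrder ![x, y, z] ![a, b, c] ↔
    (a < b ↔ x < y) ∧ (a < c ↔ x < z) ∧ (b < a ↔ y < x) ∧ (b < c ↔ y < z) ∧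
      (c < a ↔ z < x) ∧ (c < b ↔ z < y) := by
  constructor
  · intro h
    exact ⟨h 0 1, h 0 2, h 1 0, h 1 2, h 2 0, h 2 1⟩
  · rintro ⟨h1, h2, h3, h4, h5, h6⟩ i j
    fin_cases i <;> fin_cases j <;> first | assumption | simp

theorem isStepPattern_pat111 : IsStepPattern pat111 (· = ·) (· = ·) := by
  intro a b c
  simp only [pat111, Finset.mem_singleton, exists_eq_left, sameOrder_iff]
  omega

theorem isStepPattern_pat112 : IsStepPattern pat112 (· = ·) (· < ·) := by
  intro a b c
  simp only [pat112, Finset.mem_singleton, exists_eq_left, sameOrder_iff]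
  omega

theorem isStepPattern_pat221 : IsStepPattern pat221 (· = ·) (· > ·) := by
  intro a b c
  simp only [pat221, Finset.mem_singleton, exists_eq_left, sameOrder_iff]
  omega

theorem isStepPattern_pat123 : IsStepPattern pat123 (· < ·) (· < ·) := by
  intro a b c
  simp only [pat123, Finset.mem_singleton, exists_eq_left, sameOrder_iff]
  omega

theorem isStepPattern_peak : IsStepPattern peak (· < ·) (· > ·) := by
  intro a b c
  simp only [peak, Finset.mem_insert, Finset.mem_singleton, exists_eq_or_imp, exists_eq_left,
    sameOrder_iff]
  omega

theorem isStepPattern_valley : IsStepPattern valley (· > ·) (· < ·) := by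
  intro a b c
  simp only [valley, Finset.mem_insert, Finset.mem_singleton, exists_eq_or_imp, exists_eq_left,
    sameOrder_iff]
  omega

section steps

variable {P : Finset Word3} {R S : ℕ → ℕ → Prop}

theorem IsStepPattern.avoids_cons_cons (h : IsStepPattern P R S) (a b : ℕ) (w : List ℕ) :
    occurrences P (a :: b :: w) = 0 ↔ occurrences P (b :: w) = 0 ∧ ¬ (R a b ∧ HeadRel S b w) := by
  cases w with
  | nil => simp [occurrences, HeadRel]
  | cons c w =>
    rw [occurrences, Nat.add_eq_zero_iff, HeadRel, ← h a b c]
    split_ifs with h' <;> simp [h']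

variable (P) in
/-- The generating function of the words `w` over `{1, …, m}` for which `a w` avoids `P`. The
letter `a` itself is not counted; the same holds for `stepGF` and `nonstepGF`. -/
noncomputable def afterGF (m a : ℕ) : ℤ⟦X⟧ := wordGF m fun w => occurrences P (a :: w) = 0

variable (P S) in
/-- The generating function of the words `w` over `{1, …, m}` for which `b w` avoids `P` and
begins with an `S`-step. -/
noncomputable def stepGF (m b : ℕ) : ℤ⟦X⟧ :=
  wordGF m fun w => occurrences P (b :: w) = 0 ∧ HeadRel S b w

variable (P S) in
/-- The generating function of the words `w` over `{1, …, m}` for which `b w` avoids `P` and does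
not begin with an `S`-step. -/
noncomputable def nonstepGF (m b : ℕ) : ℤ⟦X⟧ :=
  wordGF m fun w => occurrences P (b :: w) = 0 ∧ ¬ HeadRel S b w

theorem afterGF_eq (m a : ℕ) : afterGF P m a = stepGF P S m a + nonstepGF P S m a :=
  wordGF_split _ _ _

theorem wordGF_false (m : ℕ) : wordGF m (fun _ => False) = 0 := by
  ext n; simp [wordGF]

theorem wordGF_avoids (P : Finset Word3) (m : ℕ) : wordGF m (fun w => occurrences P w = 0) =
    1 + ∑ b ∈ Finset.Icc 1 m, X ^ b * afterGF P m b := by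
  rw [wordGF_eq, if_pos (by rfl)]
  rfl

/-- Among the words avoiding `P`, those that no longer avoid it once `a` is put in front are the
words `b w` with `R a b` for which `b w` begins with an `S`-step. -/
theorem IsStepPattern.afterGF_add_sum [DecidableRel R] (h : IsStepPattern P R S) (m a : ℕ) :
    afterGF P m a + (∑ b ∈ (Finset.Icc 1 m),
      if R a b then X ^ b * stepGF P S m b else 0) =
      wordGF m (fun w => occurrences P w = 0) := by
  classical
  rw [wordGF_split m (fun w => occurrences P w = 0)
    (fun w => ∃ b l, w = b :: l ∧ R a b ∧ HeadRel S b l), add_comm]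
  congr 1
  · rw [wordGF_eq]
    simp only [List.nil_eq, reduceCtorEq, false_and, exists_false, and_false, if_false, zero_add]
    refine Finset.sum_congr rfl fun b _ => ?_
    split_ifs with hR
    · congr 1
      refine wordGF_congr fun l => ?_
      simp [hR]
    · symm
      convert mul_zero _
      rw [← wordGF_false m]
      refine wordGF_congr fun l => ?_
      simp [hR]
  · refine wordGF_congr fun w => ?_
    cases w with
    | nil => simp [occurrences]
    | cons b l => simp [h.avoids_cons_cons]

theorem stepGF_eq_sum [DecidableRel S] (m b : ℕ) : stepGF P S m b = ∑ c ∈ Finset.Icc 1 m,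
      if S b c then X ^ c * wordGF m (fun w => occurrences P (b :: c :: w) = 0) else 0 := by
  classical
  rw [stepGF, wordGF_eq, if_neg (by simp [HeadRel]), zero_add]
  refine Finset.sum_congr rfl fun c _ => ?_
  split_ifs with hS
  · congr 1
    refine wordGF_congr fun l => ?_
    simp [HeadRel, hS]
  · convert mul_zero _
    rw [← wordGF_false m]
    refine wordGF_congr fun l => ?_
    simp [HeadRel, hS]

/-- If `R` and `S` exclude each other, an `S`-step is never the first step of an occurrence, so it
puts no restriction on what follows. -/
theorem IsStepPattern.stepGF_of_disjoint [DecidableRel S] (h : IsStepPattern P R S)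
    (hRS : ∀ b c, S b c → ¬ R b c) (m b : ℕ) : stepGF P S m b = ∑ c ∈ Finset.Icc 1 m,
      if S b c then X ^ c * afterGF P m c else 0 := by
  rw [stepGF_eq_sum]
  refine Finset.sum_congr rfl fun c _ => ?_
  split_ifs with hS
  · congr 1
    refine wordGF_congr fun l => ?_
    simp [h.avoids_cons_cons, hRS b c hS]
  · rfl

/-- If `R = S`, an `R`-step must not be followed by another one. -/
theorem IsStepPattern.stepGF_of_eq [DecidableRel R] (h : IsStepPattern P R R) (m b : ℕ) :
    stepGF P R m b = ∑ c ∈ Finset.Icc 1 m,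
      if R b c then X ^ c * nonstepGF P R m c else 0 := by
  rw [stepGF_eq_sum]
  refine Finset.sum_congr rfl fun c _ => ?_
  split_ifs with hS
  · congr 1
    refine wordGF_congr fun l => ?_
    simp [h.avoids_cons_cons, hS]
  · rfl

end steps

section sums

theorem sum_ite_self {m a : ℕ} (ha : a ∈ Finset.Icc 1 m) (f : ℕ → ℤ⟦X⟧) :
    (∑ b ∈ Finset.Icc 1 m, if a = b then f b else 0) = f a := by
  rw [Finset.sum_ite_eq, if_pos ha]

theorem sum_ite_lt (m a : ℕ) (f : ℕ → ℤ⟦X⟧) :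
    (∑ b ∈ Finset.Icc 1 m, if a < b then f b else 0) =
      ∑ b ∈ Finset.Ioc a m, f b := by
  rw [← Finset.sum_filter]
  refine Finset.sum_congr ?_ fun _ _ => rfl
  ext b; simp only [Finset.mem_filter, Finset.mem_Icc, Finset.mem_Ioc]; omega

theorem sum_ite_gt {m k : ℕ} (hk : k ≤ m) (f : ℕ → ℤ⟦X⟧) :
    (∑ b ∈ Finset.Icc 1 m, if k + 1 > b then f b else 0) =
      ∑ b ∈ Finset.Ioc 0 k, f b := by
  rw [← Finset.sum_filter]
  refine Finset.sum_congr ?_ fun _ _ => rfl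
  ext b; simp only [Finset.mem_filter, Finset.mem_Icc, Finset.mem_Ioc]; omega

theorem sum_Ioc_succ_left {m k : ℕ} (hk : k < m) (f : ℕ → ℤ⟦X⟧) :
    ∑ b ∈ Finset.Ioc k m, f b = f (k + 1) + ∑ b ∈ Finset.Ioc (k + 1) m, f b := by
  rw [← Finset.sum_Ioc_consecutive f (Nat.le_succ k) hk]
  simp

theorem sum_Ioc_zero_succ (k : ℕ) (f : ℕ → ℤ⟦X⟧) :
    ∑ b ∈ Finset.Ioc 0 (k + 1), f b = ∑ b ∈ Finset.Ioc 0 k, f b + f (k + 1) := by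
  rw [Finset.sum_Ioc_succ_top (Nat.zero_le k)]

theorem sum_Icc_one (m : ℕ) (f : ℕ → ℤ⟦X⟧) :
    ∑ b ∈ Finset.Icc 1 m, f b = ∑ b ∈ Finset.Ioc 0 m, f b := rfl

end sums

/-! ### Denominators over finite alphabets -/

/-- For the pattern `112`: pairs `(Aₖ, Dₖ)` with `Aₖ = ∏_{i ≤ k} (1 - x²ⁱ)` and
`Dₖ = 1 - ∑_{i ≤ k} xⁱ Aᵢ₋₁`. The second component is the denominator of the generating function
over the letters `{1, …, k}`. -/
noncomputable def den112 : ℕ → ℤ⟦X⟧ × ℤ⟦X⟧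
  | 0 => (1, 1)
  | k + 1 => ((den112 k).1 - X ^ (2 * (k + 1)) * (den112 k).1,
      (den112 k).2 - X ^ (k + 1) * (den112 k).1)

/-- For the pattern `221`: `1 - den221 k` is the denominator over the letters `{1, …, k}`. -/
noncomputable def den221 : ℕ → ℤ⟦X⟧
  | 0 => 0
  | k + 1 => X ^ (k + 1) + (den221 k - X ^ (2 * (k + 1)) * den221 k)

/-- The geometric series `1 / (1 - xᵈ)`. -/
noncomputable def geom (d : ℕ) : ℤ⟦X⟧ := PowerSeries.mk fun n => if d ∣ n then 1 else 0

theorem one_sub_mul_geom {d : ℕ} (hd : 0 < d) : (1 - X ^ d) * geom d = 1 := by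
  ext n
  rw [sub_mul, one_mul, map_sub, coeff_X_pow_mul', coeff_one]
  simp only [geom, coeff_mk]
  rcases Nat.eq_zero_or_pos n with rfl | hn
  · simp [hd.ne']
  · by_cases h : d ≤ n
    · simp [h, hn.ne', Nat.dvd_sub_iff_left h (dvd_refl d)]
    · have : ¬ d ∣ n := fun h' => h (Nat.le_of_dvd hn h')
      simp [h, hn.ne', this]

/-- The series `(xᵃ + x²ᵃ) / (1 + xᵃ + x²ᵃ)`, written as `xᵃ (1 - x²ᵃ) / (1 - x³ᵃ)`: the
contribution of the letter `a` to the denominator for the pattern `111`. -/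
noncomputable def den111Term (a : ℕ) : ℤ⟦X⟧ :=
  X ^ a * (geom (3 * a) - X ^ (2 * a) * geom (3 * a))

theorem den111Term_mul {a : ℕ} (ha : 0 < a) :
    den111Term a * (1 + X ^ a + X ^ (2 * a)) = X ^ a + X ^ (2 * a) := by
  have h := one_sub_mul_geom (d := 3 * a) (by omega)
  rw [den111Term]
  rw [show 2 * a = a + a by ring, show 3 * a = a + a + a by ring] at *
  simp only [pow_add] at *
  linear_combination (X ^ a + X ^ a * X ^ a) * h

/-- The denominator for the pattern `111` over the letters `{1, …, k}`. -/
noncomputable def den111 : ℕ → ℤ⟦X⟧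
  | 0 => 1
  | k + 1 => den111 k - den111Term (k + 1)

/-- For the pattern `123`: the three components sum the elementary symmetric functions
`eⱼ(x, x², …, xᵏ)` over `j ≡ 0, 1, 2` modulo `3`; the first minus the second is the denominator. -/
noncomputable def den123 : ℕ → ℤ⟦X⟧ × ℤ⟦X⟧ × ℤ⟦X⟧
  | 0 => (1, 0, 0)
  | k + 1 => ((den123 k).1 + X ^ (k + 1) * (den123 k).2.2,
      (den123 k).2.1 + X ^ (k + 1) * (den123 k).1,
      (den123 k).2.2 + X ^ (k + 1) * (den123 k).2.1)

/-- For peaks and valleys: the product of the row `(1, s)` and the matrices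
`[[1, xⁱ], [xⁱ, 1 + x²ⁱ]]`, `i = 1, …, k`. -/
noncomputable def zigzag (s : ℤ⟦X⟧) : ℕ → ℤ⟦X⟧ × ℤ⟦X⟧
  | 0 => (1, s)
  | k + 1 => ((zigzag s k).1 + X ^ (k + 1) * (zigzag s k).2,
      (zigzag s k).2 + X ^ (k + 1) * ((zigzag s k).1 + X ^ (k + 1) * (zigzag s k).2))

/-- `T k` collects the words that begin with a letter above `k`; in `key` the letters `1, …, k` have
been eliminated. -/
theorem den112_mul (m : ℕ) :
    (den112 m).2 * wordGF m (fun w => occurrences pat112 w = 0) = 1 := by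
  have hP := isStepPattern_pat112
  set C := wordGF m (fun w => occurrences pat112 w = 0) with hC
  set T : ℕ → ℤ⟦X⟧ := fun k => ∑ b ∈ Finset.Ioc k m, X ^ b * afterGF pat112 m b with hT
  have hX : ∀ k < m, afterGF pat112 m (k + 1) = C - X ^ (k + 1) * T (k + 1) := by
    intro k hk
    rw [eq_sub_iff_add_eq, hC, ← hP.afterGF_add_sum m (k + 1),
      sum_ite_self (Finset.mem_Icc.2 ⟨by omega, hk⟩),
      hP.stepGF_of_disjoint (fun b c h => h.ne), sum_ite_lt]
  have hT' : ∀ k < m, T k = X ^ (k + 1) * afterGF pat112 m (k + 1) + T (k + 1) :=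
    fun k hk => sum_Ioc_succ_left hk _
  have key : ∀ k ≤ m, C - 1 = (den112 k).1 * T k + (1 - (den112 k).2) * C := by
    intro k
    induction k with
    | zero =>
      intro _
      rw [hC, wordGF_avoids, sum_Icc_one]
      simp [den112, hT]
    | succ k ih =>
      intro hk
      rw [ih (by omega), hT' k hk, hX k hk, den112]
      ring
  have := key m le_rfl
  rw [show T m = 0 by simp [hT]] at this
  linear_combination this

/-- `T k` collects the words that begin with a letter at most `k`. -/
theorem den221_mul (m : ℕ) :
    (1 - den221 m) * wordGF m (fun w => occurrences pat221 w = 0) = 1 := by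
  have hP := isStepPattern_pat221
  set C := wordGF m (fun w => occurrences pat221 w = 0) with hC
  set T : ℕ → ℤ⟦X⟧ := fun k => ∑ b ∈ Finset.Ioc 0 k, X ^ b * afterGF pat221 m b with hT
  have hX : ∀ k < m, afterGF pat221 m (k + 1) = C - X ^ (k + 1) * T k := by
    intro k hk
    rw [eq_sub_iff_add_eq, hC, ← hP.afterGF_add_sum m (k + 1),
      sum_ite_self (Finset.mem_Icc.2 ⟨by omega, hk⟩),
      hP.stepGF_of_disjoint (fun b c h => h.ne'), sum_ite_gt hk.le]
  have hT' : ∀ k < m, T (k + 1) = T k + X ^ (k + 1) * afterGF pat221 m (k + 1) :=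
    fun k _ => sum_Ioc_zero_succ k _
  have key : ∀ k ≤ m, T k = den221 k * C := by
    intro k
    induction k with
    | zero => intro _; simp [den221, hT]
    | succ k ih =>
      intro hk
      rw [hT' k hk, hX k hk, ih (by omega), den221]
      ring
  have h1 : C = 1 + T m := by rw [hC, wordGF_avoids]; rfl
  linear_combination h1 + key m le_rfl

theorem den111_mul (m : ℕ) :
    den111 m * wordGF m (fun w => occurrences pat111 w = 0) = 1 := by
  have hP := isStepPattern_pat111
  set C := wordGF m (fun w => occurrences pat111 w = 0) with hC
  have hX : ∀ k < m, X ^ (k + 1) * afterGF pat111 m (k + 1) = den111Term (k + 1) * C := by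
    intro k hk
    have hk' : k + 1 ∈ Finset.Icc 1 m := Finset.mem_Icc.2 ⟨by omega, hk⟩
    have h1 := hP.afterGF_add_sum m (k + 1)
    have h2 := hP.stepGF_of_eq m (k + 1)
    have h3 := afterGF_eq (P := pat111) (S := (· = ·)) m (k + 1)
    rw [sum_ite_self hk'] at h1 h2
    have h4 := den111Term_mul (Nat.succ_pos k)
    rw [← hC] at h1
    simp only [Nat.succ_eq_add_one] at h4
    rw [two_mul, pow_add _ (k + 1) (k + 1)] at h4
    generalize (X : ℤ⟦X⟧) ^ (k + 1) = y at *
    rw [← h1, h3, h2]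
    linear_combination -(nonstepGF pat111 (· = ·) m (k + 1)) * h4
  have key : ∀ k ≤ m, ∑ b ∈ Finset.Ioc 0 k, X ^ b * afterGF pat111 m b = (1 - den111 k) * C := by
    intro k
    induction k with
    | zero => intro _; simp [den111]
    | succ k ih =>
      intro hk
      rw [sum_Ioc_zero_succ, hX k hk, ih (by omega), den111]
      ring
  have h1 : C = 1 + ∑ b ∈ Finset.Ioc 0 m, X ^ b * afterGF pat111 m b := by
    rw [hC, wordGF_avoids]; rfl
  linear_combination h1 + key m le_rfl

/-- The combination in `key` is invariant under the elimination of the letter `k + 1`. -/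
theorem den123_mul (m : ℕ) : ((den123 m).1 - (den123 m).2.1) *
    wordGF m (fun w => occurrences pat123 w = 0) = 1 := by
  have hP := isStepPattern_pat123
  set C := wordGF m (fun w => occurrences pat123 w = 0) with hC
  set T : ℕ → ℤ⟦X⟧ := fun k => ∑ b ∈ Finset.Ioc k m, X ^ b * nonstepGF pat123 (· < ·) m b with hT
  set W : ℕ → ℤ⟦X⟧ := fun k => ∑ b ∈ Finset.Ioc k m, X ^ b * stepGF pat123 (· < ·) m b with hW
  have hstep : ∀ k, stepGF pat123 (· < ·) m k = T k := by
    intro k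
    rw [hP.stepGF_of_eq, sum_ite_lt]
  have hX : ∀ k, afterGF pat123 m k = C - W k := by
    intro k
    rw [eq_sub_iff_add_eq, hC, ← hP.afterGF_add_sum m k, sum_ite_lt]
  have hU : ∀ k, nonstepGF pat123 (· < ·) m k = C - W k - T k := by
    intro k
    have := afterGF_eq (P := pat123) (S := (· < ·)) m k
    rw [hX, hstep] at this
    linear_combination -this
  have hT' : ∀ k < m, T k = X ^ (k + 1) * (C - W (k + 1) - T (k + 1)) + T (k + 1) := by
    intro k hk
    rw [← hU]
    exact sum_Ioc_succ_left hk _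
  have hW' : ∀ k < m, W k = X ^ (k + 1) * T (k + 1) + W (k + 1) := by
    intro k hk
    rw [← hstep]
    exact sum_Ioc_succ_left hk _
  have key : ∀ k ≤ m, (den123 k).1 * (C - W k - T k) + (den123 k).2.1 * (W k - C) +
      (den123 k).2.2 * T k = 1 := by
    intro k
    induction k with
    | zero =>
      intro _
      have : C = 1 + (T 0 + W 0) := by
        rw [hC, wordGF_avoids, sum_Icc_one, hT, hW, ← Finset.sum_add_distrib]
        simp only [← mul_add, afterGF_eq (P := pat123) (S := (· < ·)), add_comm]
      simp only [den123]
      linear_combination this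
    | succ k ih =>
      intro hk
      rw [← ih (by omega), hT' k hk, hW' k hk, den123]
      ring
  have := key m le_rfl
  rw [show T m = 0 by simp [hT], show W m = 0 by simp [hW]] at this
  linear_combination this

/-- Both the words that avoid peaks after a letter `k` and the partial sums `T k` are multiples of
the series `C - W 0`; at `k = m` they become `C` and `C - 1`. -/
theorem zigzag_peak_mul (m : ℕ) : ((zigzag 0 m).1 - (zigzag 0 m).2) *
    wordGF m (fun w => occurrences peak w = 0) = (zigzag 0 m).1 := by
  have hP := isStepPattern_peak
  set C := wordGF m (fun w => occurrences peak w = 0) with hC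
  set T : ℕ → ℤ⟦X⟧ := fun k => ∑ b ∈ Finset.Ioc 0 k, X ^ b * afterGF peak m b with hT
  set W : ℕ → ℤ⟦X⟧ := fun k => ∑ b ∈ Finset.Ioc k m, X ^ b * stepGF peak (· > ·) m b with hW
  have hstep : ∀ k < m, stepGF peak (· > ·) m (k + 1) = T k := by
    intro k hk
    rw [hP.stepGF_of_disjoint (fun b c h => by simp only [gt_iff_lt] at *; omega), sum_ite_gt hk.le]
  have hX : ∀ k, afterGF peak m k = C - W k := by
    intro k
    rw [eq_sub_iff_add_eq, hC, ← hP.afterGF_add_sum m k, sum_ite_lt]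
  have hT' : ∀ k < m, T (k + 1) = T k + X ^ (k + 1) * (C - W (k + 1)) := by
    intro k hk
    rw [← hX]
    exact sum_Ioc_zero_succ k _
  have hW' : ∀ k < m, W k = X ^ (k + 1) * T k + W (k + 1) := by
    intro k hk
    rw [← hstep k hk]
    exact sum_Ioc_succ_left hk _
  have key : ∀ k ≤ m, C - W k = (zigzag 0 k).1 * (C - W 0) ∧ T k = (zigzag 0 k).2 * (C - W 0) := by
    intro k
    induction k with
    | zero => intro _; simp [zigzag, hT]
    | succ k ih =>
      intro hk
      obtain ⟨h1, h2⟩ := ih (by omega)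
      have h3 := hW' k hk
      have h4 := hT' k hk
      have h5 : C - W (k + 1) = (zigzag 0 (k + 1)).1 * (C - W 0) := by
        simp only [zigzag]
        linear_combination h1 + X ^ (k + 1) * h2 + h3
      refine ⟨h5, ?_⟩
      rw [h4, h5]
      simp only [zigzag]
      linear_combination h2
  obtain ⟨h1, h2⟩ := key m le_rfl
  have h3 : C = 1 + T m := by rw [hC, wordGF_avoids]; rfl
  rw [show W m = 0 by simp [hW], sub_zero] at h1
  linear_combination (zigzag 0 m).1 * (h3 + h2) - (zigzag 0 m).2 * h1

/-- The pair `(C - W k, T k)` goes from `(C, C - 1)` at `k = 0` to a multiple of `(1, 0)` at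
`k = m`, and the transfer matrices are those of `zigzag`; pairing with the rows `(1, 0)` and
`(1, -1)` gives two equations, from which the unknown multiple is eliminated. -/
theorem zigzag_valley_mul (m : ℕ) : (zigzag (-1) m).1 *
    wordGF m (fun w => occurrences valley w = 0) = (zigzag 0 m).1 := by
  have hP := isStepPattern_valley
  set C := wordGF m (fun w => occurrences valley w = 0) with hC
  set T : ℕ → ℤ⟦X⟧ := fun k => ∑ b ∈ Finset.Ioc k m, X ^ b * afterGF valley m b with hT
  set W : ℕ → ℤ⟦X⟧ := fun k => ∑ b ∈ Finset.Ioc 0 k, X ^ b * stepGF valley (· < ·) m b with hW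
  have hstep : ∀ k, stepGF valley (· < ·) m k = T k := by
    intro k
    rw [hP.stepGF_of_disjoint (fun b c h => by simp only [gt_iff_lt] at *; omega), sum_ite_lt]
  have hX : ∀ k < m, afterGF valley m (k + 1) = C - W k := by
    intro k hk
    rw [eq_sub_iff_add_eq, hC, ← hP.afterGF_add_sum m (k + 1), sum_ite_gt hk.le]
  have hT' : ∀ k < m, T k = X ^ (k + 1) * (C - W k) + T (k + 1) := by
    intro k hk
    rw [← hX k hk]
    exact sum_Ioc_succ_left hk _
  have hW' : ∀ k < m, W (k + 1) = W k + X ^ (k + 1) * T (k + 1) := by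
    intro k hk
    rw [← hstep]
    exact sum_Ioc_zero_succ k _
  have key : ∀ s : ℤ⟦X⟧, ∀ k ≤ m,
      (zigzag s k).1 * (C - W k) + (zigzag s k).2 * T k = C + s * (C - 1) := by
    intro s k
    induction k with
    | zero =>
      intro _
      have : C = 1 + T 0 := by rw [hC, wordGF_avoids]; rfl
      simp only [zigzag, show W 0 = 0 by simp [hW]]
      linear_combination -s * this
    | succ k ih =>
      intro hk
      rw [← ih (by omega), hT' k hk, ← sub_eq_zero]
      simp only [zigzag]
      rw [hW' k hk]
      ring
  have h1 := key 0 m le_rfl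
  have h2 := key (-1) m le_rfl
  rw [show T m = 0 by simp [hT]] at h1 h2
  linear_combination (zigzag 0 m).1 * h2 - (zigzag (-1) m).1 * h1

/-! ### Infinite alphabet as a limit -/

/-- The `m`-th term agrees with its successor up to degree `m`. -/
def IsStable (s : ℕ → ℤ⟦X⟧) : Prop := ∀ m, X ^ (m + 1) ∣ s (m + 1) - s m

/-- The coefficientwise limit of a stable sequence of power series. -/
noncomputable def stableLim (s : ℕ → ℤ⟦X⟧) : ℤ⟦X⟧ := PowerSeries.mk fun n => coeff n (s n)

theorem IsStable.dvd_sub_of_le {s : ℕ → ℤ⟦X⟧} (hs : IsStable s) {n m : ℕ} (h : n ≤ m) :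
    X ^ (n + 1) ∣ s m - s n := by
  induction m, h using Nat.le_induction with
  | base => simp
  | succ m hm ih =>
    have := dvd_add ((pow_dvd_pow X (Nat.succ_le_succ hm)).trans (hs m)) ih
    simpa using this

theorem IsStable.coeff_stableLim {s : ℕ → ℤ⟦X⟧} (hs : IsStable s) {n m : ℕ} (h : n ≤ m) :
    coeff n (stableLim s) = coeff n (s m) := by
  have := X_pow_dvd_iff.1 (hs.dvd_sub_of_le h) n (Nat.lt_succ_self n)
  rw [map_sub, sub_eq_zero] at this
  rw [this, stableLim, coeff_mk]

theorem IsStable.dvd_sub_stableLim {s : ℕ → ℤ⟦X⟧} (hs : IsStable s) (m : ℕ) :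
    X ^ (m + 1) ∣ s m - stableLim s := by
  rw [X_pow_dvd_iff]
  intro n hn
  rw [map_sub, hs.coeff_stableLim (Nat.lt_succ_iff.1 hn), sub_self]

theorem eq_of_forall_X_pow_dvd {f g : ℤ⟦X⟧} (h : ∀ m, X ^ (m + 1) ∣ f - g) : f = g := by
  ext n
  have := X_pow_dvd_iff.1 (h n) n (Nat.lt_succ_self n)
  rwa [map_sub, sub_eq_zero] at this

/-- Identities over the finite alphabets `{1, …, m}` pass to the limit. -/
theorem IsStable.stableLim_mul_avoidGF {D N : ℕ → ℤ⟦X⟧} (hD : IsStable D) (hN : IsStable N)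
    {P : Finset Word3} (h : ∀ m, D m * wordGF m (fun w => occurrences P w = 0) = N m) :
    stableLim D * avoidGF P = stableLim N := by
  refine eq_of_forall_X_pow_dvd fun m => ?_
  have h1 := hD.dvd_sub_stableLim m
  have h2 := hN.dvd_sub_stableLim m
  have h3 := X_pow_dvd_avoidGF_sub P m
  have h4 := dvd_sub h2 (dvd_add (h1.mul_right (wordGF m fun w => occurrences P w = 0))
    (h3.mul_left (stableLim D)))
  convert h4 using 1
  linear_combination h m

theorem isStable_const (f : ℤ⟦X⟧) : IsStable fun _ => f := fun m => by simp

theorem stableLim_const (f : ℤ⟦X⟧) : stableLim (fun _ => f) = f := by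
  ext n; simp [stableLim]

theorem IsStable.sub {s t : ℕ → ℤ⟦X⟧} (hs : IsStable s) (ht : IsStable t) :
    IsStable fun m => s m - t m := fun m => by
  have := dvd_sub (hs m) (ht m)
  convert this using 1
  ring

theorem isStable_of_eq {s t : ℕ → ℤ⟦X⟧} (h : ∀ m, s (m + 1) = s m + X ^ (m + 1) * t m) :
    IsStable s := fun m => ⟨t m, by rw [h]; ring⟩

theorem isStable_den112 : IsStable fun m => (den112 m).2 :=
  isStable_of_eq (t := fun m => -(den112 m).1) fun m => by simp only [den112]; ring

theorem isStable_den221 : IsStable fun m => 1 - den221 m :=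
  isStable_of_eq (t := fun m => -1 + X ^ (m + 1) * den221 m) fun m => by
    simp only [den221]; ring

theorem isStable_den111 : IsStable den111 :=
  isStable_of_eq (t := fun m => -(geom (3 * (m + 1)) - X ^ (2 * (m + 1)) * geom (3 * (m + 1))))
    fun m => by simp only [den111, den111Term]; ring

theorem isStable_den123 : IsStable fun m => (den123 m).1 - (den123 m).2.1 :=
  isStable_of_eq (t := fun m => (den123 m).2.2 - (den123 m).1) fun m => by
    simp only [den123]; ring

theorem isStable_zigzag_fst (s : ℤ⟦X⟧) : IsStable fun m => (zigzag s m).1 :=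
  isStable_of_eq (t := fun m => (zigzag s m).2) fun m => by simp only [zigzag]

theorem isStable_zigzag_snd (s : ℤ⟦X⟧) : IsStable fun m => (zigzag s m).2 :=
  isStable_of_eq (t := fun m => (zigzag s m).1 + X ^ (m + 1) * (zigzag s m).2) fun m => by
    simp only [zigzag]

/-! ### Bounds for the coefficients of the denominators -/

/-- The `n`-th partial sum of the weighted `ℓ¹` norm `∑ |fₖ| Rᵏ`. -/
noncomputable def partialNorm (R : ℝ) (n : ℕ) (f : ℤ⟦X⟧) : ℝ :=
  ∑ k ∈ Finset.range n, |((coeff k f : ℤ) : ℝ)| * R ^ k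

section partialNorm

variable {R : ℝ} (hR : 0 ≤ R) (n : ℕ)
include hR

theorem partialNorm_nonneg (f : ℤ⟦X⟧) : 0 ≤ partialNorm R n f :=
  Finset.sum_nonneg fun _ _ => by positivity

theorem partialNorm_add_le (f g : ℤ⟦X⟧) :
    partialNorm R n (f + g) ≤ partialNorm R n f + partialNorm R n g := by
  rw [partialNorm, partialNorm, partialNorm, ← Finset.sum_add_distrib]
  refine Finset.sum_le_sum fun k _ => ?_
  rw [← add_mul, map_add, Int.cast_add]
  gcongr
  exact abs_add_le _ _

theorem partialNorm_sub_le (f g : ℤ⟦X⟧) :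
    partialNorm R n (f - g) ≤ partialNorm R n f + partialNorm R n g := by
  rw [partialNorm, partialNorm, partialNorm, ← Finset.sum_add_distrib]
  refine Finset.sum_le_sum fun k _ => ?_
  rw [← add_mul, map_sub, Int.cast_sub]
  gcongr
  exact abs_sub _ _

theorem partialNorm_X_pow_mul_le (a : ℕ) (f : ℤ⟦X⟧) :
    partialNorm R n (X ^ a * f) ≤ R ^ a * partialNorm R n f := by
  rcases le_total n a with h | h
  · rw [partialNorm, Finset.sum_eq_zero]
    · exact mul_nonneg (by positivity) (partialNorm_nonneg hR n f)
    · intro k hk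
      rw [coeff_X_pow_mul', if_neg (by simp at hk; omega)]
      simp
  · obtain ⟨d, rfl⟩ := Nat.exists_eq_add_of_le h
    rw [partialNorm, Finset.sum_range_add, Finset.sum_eq_zero, zero_add]
    · calc ∑ k ∈ Finset.range d, |((coeff (a + k) (X ^ a * f) : ℤ) : ℝ)| * R ^ (a + k)
          = R ^ a * partialNorm R d f := by
            rw [partialNorm, Finset.mul_sum]
            refine Finset.sum_congr rfl fun k _ => ?_
            rw [coeff_X_pow_mul', if_pos (by omega), Nat.add_sub_cancel_left, pow_add]
            ring
        _ ≤ _ := by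
            gcongr
            refine Finset.sum_le_sum_of_subset_of_nonneg (Finset.range_mono (by omega)) ?_
            intros; positivity
    · intro k hk
      rw [coeff_X_pow_mul', if_neg (by simp at hk; omega)]
      simp

omit hR in
theorem partialNorm_one_le : partialNorm R n 1 ≤ 1 := by
  rw [partialNorm]
  calc _ ≤ ∑ k ∈ Finset.range n, if k = 0 then (1 : ℝ) else 0 := by
        refine Finset.sum_le_sum fun k _ => ?_
        rw [coeff_one]
        split_ifs with h <;> simp [h]
    _ ≤ 1 := by rw [Finset.sum_ite_eq']; split_ifs <;> norm_num

theorem partialNorm_X_pow_le (a : ℕ) : partialNorm R n (X ^ a) ≤ R ^ a := by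
  have h1 := partialNorm_X_pow_mul_le hR n a 1
  have h2 := partialNorm_one_le (R := R) n
  rw [mul_one] at h1
  exact h1.trans (mul_le_of_le_one_right (by positivity) h2)

theorem abs_coeff_mul_le_partialNorm (f : ℤ⟦X⟧) :
    |((coeff n f : ℤ) : ℝ)| * R ^ n ≤ partialNorm R (n + 1) f :=
  Finset.single_le_sum (f := fun k => |((coeff k f : ℤ) : ℝ)| * R ^ k)
    (fun _ _ => by positivity) (Finset.self_mem_range_succ n)

omit hR in
theorem partialNorm_neg (f : ℤ⟦X⟧) : partialNorm R n (-f) = partialNorm R n f := by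
  simp [partialNorm]

end partialNorm

/-- A majorant, uniform in the patterns other than `111`, of the norms at radius `R` of the
denominators over the letters `{1, …, m}`. -/
noncomputable def growth (R : ℝ) (m : ℕ) : ℝ :=
  Real.exp (∑ k ∈ Finset.range m, (R ^ (k + 1) + R ^ (2 * (k + 1))))

section growth

variable {R : ℝ} (hR : 0 ≤ R) (n m : ℕ)
include hR

theorem one_le_growth : 1 ≤ growth R m :=
  Real.one_le_exp (Finset.sum_nonneg fun _ _ => by positivity)

omit hR in
theorem growth_mul_le : growth R m * (1 + R ^ (m + 1) + R ^ (2 * (m + 1))) ≤ growth R (m + 1) := by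
  rw [growth, growth, Finset.sum_range_succ, Real.exp_add]
  gcongr
  rw [add_assoc, add_comm]
  exact Real.add_one_le_exp _

theorem partialNorm_den112_le : partialNorm R n (den112 m).1 ≤ growth R m ∧
    partialNorm R n (den112 m).2 ≤ growth R m := by
  induction m with
  | zero => simpa [den112, growth] using partialNorm_one_le (R := R) n
  | succ m ih =>
    obtain ⟨h1, h2⟩ := ih
    have h3 := growth_mul_le (R := R) m
    have h4 := one_le_growth hR m
    have hx : 0 ≤ R ^ (m + 1) := by positivity
    have hx' : 0 ≤ R ^ (2 * (m + 1)) := by positivity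
    constructor
    · have h5 := partialNorm_sub_le hR n (den112 m).1 (X ^ (2 * (m + 1)) * (den112 m).1)
      have h6 := partialNorm_X_pow_mul_le hR n (2 * (m + 1)) (den112 m).1
      simp only [den112]
      nlinarith
    · have h5 := partialNorm_sub_le hR n (den112 m).2 (X ^ (m + 1) * (den112 m).1)
      have h6 := partialNorm_X_pow_mul_le hR n (m + 1) (den112 m).1
      simp only [den112]
      nlinarith

theorem partialNorm_den221_le : 1 + partialNorm R n (den221 m) ≤ growth R m := by
  induction m with
  | zero => simp [den221, growth, partialNorm]
  | succ m ih =>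
    have h3 := growth_mul_le (R := R) m
    have h4 := one_le_growth hR m
    have hx : 0 ≤ R ^ (m + 1) := by positivity
    have hx' : 0 ≤ R ^ (2 * (m + 1)) := by positivity
    have h0 := partialNorm_add_le hR n (X ^ (m + 1)) (den221 m - X ^ (2 * (m + 1)) * den221 m)
    have h1 := partialNorm_X_pow_le hR n (m + 1)
    have h5 := partialNorm_sub_le hR n (den221 m) (X ^ (2 * (m + 1)) * den221 m)
    have h6 := partialNorm_X_pow_mul_le hR n (2 * (m + 1)) (den221 m)
    simp only [den221]
    nlinarith

theorem partialNorm_den123_le : partialNorm R n (den123 m).1 ≤ growth R m ∧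
    partialNorm R n (den123 m).2.1 ≤ growth R m ∧ partialNorm R n (den123 m).2.2 ≤ growth R m := by
  induction m with
  | zero =>
    refine ⟨?_, ?_, ?_⟩
    · simpa [den123, growth] using partialNorm_one_le (R := R) n
    · simp [den123, growth, partialNorm]
    · simp [den123, growth, partialNorm]
  | succ m ih =>
    obtain ⟨h1, h2, h2'⟩ := ih
    have h3 := growth_mul_le (R := R) m
    have h4 := one_le_growth hR m
    have hx : 0 ≤ R ^ (m + 1) := by positivity
    have hx' : 0 ≤ R ^ (2 * (m + 1)) := by positivity
    have aux : ∀ f g : ℤ⟦X⟧, partialNorm R n f ≤ growth R m → partialNorm R n g ≤ growth R m →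
        partialNorm R n (f + X ^ (m + 1) * g) ≤ growth R (m + 1) := by
      intro f g hf hg
      have h5 := partialNorm_add_le hR n f (X ^ (m + 1) * g)
      have h6 := partialNorm_X_pow_mul_le hR n (m + 1) g
      nlinarith
    exact ⟨aux _ _ h1 h2', aux _ _ h2 h1, aux _ _ h2' h2⟩

theorem partialNorm_zigzag_le {s : ℤ⟦X⟧} (hs : partialNorm R n s ≤ 1) :
    partialNorm R n (zigzag s m).1 ≤ growth R m ∧ partialNorm R n (zigzag s m).2 ≤ growth R m := by
  induction m with
  | zero => simpa [zigzag, growth, hs] using partialNorm_one_le (R := R) n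
  | succ m ih =>
    obtain ⟨h1, h2⟩ := ih
    have h3 := growth_mul_le (R := R) m
    have h4 := one_le_growth hR m
    have hx : 0 ≤ R ^ (m + 1) := by positivity
    have h5 := partialNorm_add_le hR n (zigzag s m).1 (X ^ (m + 1) * (zigzag s m).2)
    have h6 := partialNorm_X_pow_mul_le hR n (m + 1) (zigzag s m).2
    have h7 := partialNorm_add_le hR n (zigzag s m).2
      (X ^ (m + 1) * ((zigzag s m).1 + X ^ (m + 1) * (zigzag s m).2))
    have h8 := partialNorm_X_pow_mul_le hR n (m + 1)
      ((zigzag s m).1 + X ^ (m + 1) * (zigzag s m).2)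
    rw [two_mul (m + 1), pow_add _ (m + 1)] at h3
    simp only [zigzag]
    generalize R ^ (m + 1) = x at *
    have h9 : partialNorm R n ((zigzag s m).1 + X ^ (m + 1) * (zigzag s m).2) ≤
        growth R m * (1 + x) := by nlinarith
    constructor
    · nlinarith
    · nlinarith [mul_le_mul_of_nonneg_left h9 hx]

end growth

/-- At `R = 17/20` the exponent of `growth` stays below `17/3 + 289/111 < 8.3`, and
`exp 8.3 < 4100`. -/
theorem growth_le (m : ℕ) : growth (17 / 20) m ≤ 4100 := by
  have h1 : ∑ k ∈ Finset.range m, ((17 / 20 : ℝ) ^ (k + 1) + (17 / 20) ^ (2 * (k + 1))) ≤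
      83 / 10 := by
    have h : ∀ k, ((17 / 20 : ℝ) ^ (k + 1) + (17 / 20) ^ (2 * (k + 1))) =
        17 / 20 * (17 / 20) ^ k + 289 / 400 * (289 / 400) ^ k := by
      intro k
      rw [pow_succ', pow_mul, pow_succ' _ k]
      norm_num
    simp only [h, Finset.sum_add_distrib, ← Finset.mul_sum]
    rw [show ∑ k ∈ Finset.range m, (17 / 20 : ℝ) ^ k = 20 / 3 * (1 - (17 / 20) ^ m) by
        rw [geom_sum_eq (by norm_num), div_eq_iff (by norm_num)]; ring,
      show ∑ k ∈ Finset.range m, (289 / 400 : ℝ) ^ k = 400 / 111 * (1 - (289 / 400) ^ m) by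
        rw [geom_sum_eq (by norm_num), div_eq_iff (by norm_num)]; ring]
    have := pow_nonneg (by norm_num : (0 : ℝ) ≤ 17 / 20) m
    have := pow_nonneg (by norm_num : (0 : ℝ) ≤ 289 / 400) m
    linarith
  refine (Real.exp_le_exp.2 h1).trans ?_
  refine le_of_pow_le_pow_left₀ (n := 10) (by norm_num) (by norm_num) ?_
  rw [← Real.exp_nat_mul, show ((10 : ℕ) : ℝ) * (83 / 10) = ((83 : ℕ) : ℝ) * 1 by norm_num,
    Real.exp_nat_mul]
  calc Real.exp 1 ^ 83 ≤ 2.7182818286 ^ 83 := by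
        gcongr
        exact Real.exp_one_lt_d9.le
    _ ≤ 4100 ^ 10 := by norm_num

theorem partialNorm_geom_le (n d : ℕ) : partialNorm (17 / 20) n (geom d) ≤ 20 / 3 := by
  calc partialNorm (17 / 20) n (geom d) ≤ ∑ k ∈ Finset.range n, (17 / 20 : ℝ) ^ k := by
        refine Finset.sum_le_sum fun k _ => ?_
        rw [geom, coeff_mk]
        split_ifs
        · simp
        · simp; positivity
    _ ≤ 20 / 3 := by
        rw [show ∑ k ∈ Finset.range n, (17 / 20 : ℝ) ^ k = 20 / 3 * (1 - (17 / 20) ^ n) by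
          rw [geom_sum_eq (by norm_num), div_eq_iff (by norm_num)]; ring]
        have := pow_nonneg (by norm_num : (0 : ℝ) ≤ 17 / 20) n
        linarith

theorem partialNorm_den111_le (n m : ℕ) :
    partialNorm (17 / 20) n (den111 m) ≤ 80 - 70 * (17 / 20) ^ m := by
  have hR : (0 : ℝ) ≤ 17 / 20 := by norm_num
  induction m with
  | zero =>
    have := partialNorm_one_le (R := 17 / 20) n
    simp only [den111, pow_zero]
    linarith
  | succ m ih =>
    have h1 := partialNorm_sub_le hR n (den111 m) (den111Term (m + 1))
    have h2 := partialNorm_X_pow_mul_le hR n (m + 1)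
      (geom (3 * (m + 1)) - X ^ (2 * (m + 1)) * geom (3 * (m + 1)))
    have h3 := partialNorm_sub_le hR n (geom (3 * (m + 1)))
      (X ^ (2 * (m + 1)) * geom (3 * (m + 1)))
    have h4 := partialNorm_X_pow_mul_le hR n (2 * (m + 1)) (geom (3 * (m + 1)))
    have h5 := partialNorm_geom_le n (3 * (m + 1))
    have h6 := partialNorm_nonneg hR n (geom (3 * (m + 1)))
    have h7 : ((17 : ℝ) / 20) ^ (2 * (m + 1)) ≤ 17 / 20 := by
      calc ((17 : ℝ) / 20) ^ (2 * (m + 1)) ≤ (17 / 20) ^ 1 :=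
            pow_le_pow_of_le_one hR (by norm_num) (by omega)
        _ = _ := pow_one _
    rw [den111, den111Term] at *
    have h8 : (0 : ℝ) < (17 / 20) ^ m := by positivity
    rw [pow_succ (17 / 20 : ℝ) m] at h2 ⊢
    have h9 : partialNorm (17 / 20) n (geom (3 * (m + 1)) - X ^ (2 * (m + 1)) * geom (3 * (m + 1)))
      ≤ 37 / 3 := by nlinarith
    nlinarith

/-! ### Coefficient asymptotics from a dominant simple root -/

/-- The power series `f` converges absolutely at radius `r`. -/
def WSummable (r : ℝ) (f : ℝ⟦X⟧) : Prop := Summable fun k => |coeff k f| * r ^ k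

/-- The value of the power series `f` at `x`. -/
noncomputable def evalAt (f : ℝ⟦X⟧) (x : ℝ) : ℝ := ∑' k, coeff k f * x ^ k

theorem WSummable.norm_at {r : ℝ} {f : ℝ⟦X⟧} (hf : WSummable r f) {x : ℝ} (hx : 0 ≤ x)
    (hxr : x ≤ r) : Summable fun k => ‖coeff k f * x ^ k‖ := by
  refine Summable.of_nonneg_of_le (fun _ => norm_nonneg _) (fun k => ?_) hf
  rw [norm_mul, Real.norm_eq_abs, Real.norm_of_nonneg (by positivity)]
  gcongr

theorem WSummable.summable {r : ℝ} {f : ℝ⟦X⟧} (hf : WSummable r f) {x : ℝ} (hx : 0 ≤ x)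
    (hxr : x ≤ r) : Summable fun k => coeff k f * x ^ k := (hf.norm_at hx hxr).of_norm

theorem coeff_mul_mul_pow (f g : ℝ⟦X⟧) (x : ℝ) (n : ℕ) : coeff n (f * g) * x ^ n =
    ∑ p ∈ Finset.HasAntidiagonal.antidiagonal n,
      (coeff p.1 f * x ^ p.1) * (coeff p.2 g * x ^ p.2) := by
  rw [coeff_mul, Finset.sum_mul]
  refine Finset.sum_congr rfl fun p hp => ?_
  rw [← Finset.HasAntidiagonal.mem_antidiagonal.1 hp, pow_add]
  ring

theorem WSummable.mul {r : ℝ} (hr : 0 ≤ r) {f g : ℝ⟦X⟧} (hf : WSummable r f)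
    (hg : WSummable r g) : WSummable r (f * g) := by
  have := summable_norm_sum_mul_antidiagonal_of_summable_norm (hf.norm_at hr le_rfl)
    (hg.norm_at hr le_rfl)
  refine this.congr fun n => ?_
  rw [← coeff_mul_mul_pow, norm_mul, Real.norm_eq_abs, Real.norm_of_nonneg (by positivity)]

theorem evalAt_mul {r : ℝ} {f g : ℝ⟦X⟧} (hf : WSummable r f) (hg : WSummable r g) {x : ℝ}
    (hx : 0 ≤ x) (hxr : x ≤ r) : evalAt (f * g) x = evalAt f x * evalAt g x := by
  rw [evalAt, evalAt, evalAt, tsum_mul_tsum_eq_tsum_sum_antidiagonal_of_summable_norm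
    (hf.norm_at hx hxr) (hg.norm_at hx hxr)]
  exact tsum_congr fun n => coeff_mul_mul_pow f g x n

/-- The quotient of `f` by `1 - x / ρ`. -/
noncomputable def deflate (ρ : ℝ) (f : ℝ⟦X⟧) : ℝ⟦X⟧ := f * PowerSeries.mk fun n => (ρ⁻¹) ^ n

theorem one_sub_mul_mk_pow (v : ℝ) :
    (1 - PowerSeries.C v * X) * (PowerSeries.mk fun n => v ^ n) = (1 : ℝ⟦X⟧) := by
  ext n
  rw [sub_mul, one_mul, map_sub, mul_assoc, coeff_C_mul, coeff_one]
  cases n with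
  | zero => simp
  | succ n => simp [coeff_succ_X_mul, pow_succ']

/-- Up to powers of `ρ`, the coefficients of `deflate ρ f` are the partial sums of `f(ρ)`. -/
theorem coeff_deflate {ρ : ℝ} (hρ : 0 < ρ) (f : ℝ⟦X⟧) (n : ℕ) :
    coeff n (deflate ρ f) * ρ ^ n = ∑ k ∈ Finset.range (n + 1), coeff k f * ρ ^ k := by
  rw [deflate, coeff_mul, Finset.Nat.sum_antidiagonal_eq_sum_range_succ_mk, Finset.sum_mul]
  refine Finset.sum_congr rfl fun k hk => ?_
  have hk' : k ≤ n := by simpa [Nat.lt_succ_iff] using hk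
  rw [coeff_mk, mul_assoc]
  congr 1
  obtain ⟨d, rfl⟩ := Nat.exists_eq_add_of_le hk'
  rw [Nat.add_sub_cancel_left, pow_add, mul_comm (ρ ^ k), ← mul_assoc, ← mul_pow,
    inv_mul_cancel₀ hρ.ne', one_pow, one_mul]

section root

variable {r ρ : ℝ} (hρ : 0 < ρ) (hρr : ρ < r) {f : ℝ⟦X⟧} (hf : WSummable r f)
  (hroot : evalAt f ρ = 0)
include hρ hρr hf hroot

theorem coeff_deflate_eq_tsum (n : ℕ) : coeff n (deflate ρ f) * ρ ^ n =
    - ∑' j, coeff (j + (n + 1)) f * ρ ^ (j + (n + 1)) := by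
  rw [coeff_deflate hρ, eq_neg_iff_add_eq_zero]
  exact ((hf.summable hρ.le hρr.le).sum_add_tsum_nat_add (n + 1)).trans hroot

theorem abs_coeff_deflate_le (n : ℕ) : |coeff n (deflate ρ f)| * r ^ n ≤
    ∑' j, |coeff (j + (n + 1)) f| * r ^ (j + (n + 1)) * (ρ / r) ^ (j + 1) := by
  have hr : 0 < r := hρ.trans hρr
  have h1 : |coeff n (deflate ρ f)| * ρ ^ n ≤
      ∑' j, |coeff (j + (n + 1)) f| * ρ ^ (j + (n + 1)) := by
    rw [← abs_of_pos (pow_pos hρ n), ← abs_mul, coeff_deflate_eq_tsum hρ hρr hf hroot, abs_neg]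
    have h2 : Summable fun j => ‖coeff (j + (n + 1)) f * ρ ^ (j + (n + 1))‖ :=
      (summable_nat_add_iff (n + 1)).2 (hf.norm_at hρ.le hρr.le)
    refine (norm_tsum_le_tsum_norm h2).trans (le_of_eq (tsum_congr fun j => ?_))
    rw [norm_mul, Real.norm_eq_abs, Real.norm_of_nonneg (by positivity)]
  calc |coeff n (deflate ρ f)| * r ^ n = (|coeff n (deflate ρ f)| * ρ ^ n) * (r / ρ) ^ n := by
        rw [mul_assoc, ← mul_pow, mul_div_cancel₀ _ hρ.ne']
    _ ≤ (∑' j, |coeff (j + (n + 1)) f| * ρ ^ (j + (n + 1))) * (r / ρ) ^ n := by gcongr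
    _ = _ := by
        rw [← tsum_mul_right]
        refine tsum_congr fun j => ?_
        have e1 : r ^ (j + (n + 1)) * (ρ / r) ^ (j + 1) = r ^ n * ρ ^ (j + 1) := by
          rw [show j + (n + 1) = n + (j + 1) by ring, pow_add, mul_assoc, ← mul_pow,
            mul_div_cancel₀ _ hr.ne']
        have e2 : ρ ^ (j + (n + 1)) * (r / ρ) ^ n = r ^ n * ρ ^ (j + 1) := by
          rw [show j + (n + 1) = (j + 1) + n by ring, pow_add, mul_assoc, ← mul_pow,
            mul_div_cancel₀ _ hρ.ne', mul_comm]
        rw [mul_assoc, mul_assoc, e1, e2]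

/-- If `f(ρ) = 0`, only the coefficients of `f` from degree `2` on contribute to the nonconstant
coefficients of `f / (1 - x / ρ)`. -/
theorem sum_abs_coeff_deflate_le {ε : ℝ}
    (hε : ∀ n, ∑ k ∈ Finset.range n, |coeff (k + 2) f| * r ^ (k + 2) ≤ ε) (n : ℕ) :
    ∑ k ∈ Finset.range n, |coeff (k + 1) (deflate ρ f)| * r ^ (k + 1) ≤ ε * (ρ / (r - ρ)) := by
  have hr : 0 < r := hρ.trans hρr
  have ht : ρ / r < 1 := (div_lt_one hr).2 hρr
  have ht0 : 0 ≤ ρ / r := by positivity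
  have hterm : ∀ k, Summable fun j =>
      |coeff (j + (k + 1)) f| * r ^ (j + (k + 1)) * (ρ / r) ^ (j + 1) := by
    intro k
    refine Summable.of_nonneg_of_le (fun _ => by positivity) (fun j => ?_)
      ((summable_nat_add_iff (f := fun k => |coeff k f| * r ^ k) (k + 1)).2 hf)
    exact mul_le_of_le_one_right (by positivity) (pow_le_one₀ ht0 ht.le)
  have hgeo : HasSum (fun j => (ρ / r) ^ (j + 1)) (ρ / (r - ρ)) := by
    have := (hasSum_geometric_of_lt_one ht0 ht).mul_left (ρ / r)
    have e : ρ / r * (1 - ρ / r)⁻¹ = ρ / (r - ρ) := by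
      have := (sub_pos.2 hρr).ne'
      field_simp
    rw [e] at this
    simpa [pow_succ'] using this
  calc _ ≤ ∑ k ∈ Finset.range n, ∑' j,
        |coeff (j + (k + 1 + 1)) f| * r ^ (j + (k + 1 + 1)) * (ρ / r) ^ (j + 1) :=
        Finset.sum_le_sum fun k _ => abs_coeff_deflate_le hρ hρr hf hroot (k + 1)
    _ = ∑' j, ∑ k ∈ Finset.range n,
        |coeff (j + (k + 1 + 1)) f| * r ^ (j + (k + 1 + 1)) * (ρ / r) ^ (j + 1) :=
        (Summable.tsum_finsetSum fun k _ => hterm (k + 1)).symm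
    _ ≤ ∑' j, ε * (ρ / r) ^ (j + 1) := by
        refine Summable.tsum_le_tsum (fun j => ?_) (summable_sum fun k _ => hterm (k + 1))
          (hgeo.summable.mul_left ε)
        rw [← Finset.sum_mul]
        gcongr
        refine le_trans ?_ (hε (j + n))
        rw [Finset.sum_range_add]
        refine le_add_of_nonneg_of_le (Finset.sum_nonneg fun _ _ => by positivity) (le_of_eq ?_)
        exact Finset.sum_congr rfl fun k _ => by rw [add_assoc j k 2]
    _ = ε * (ρ / (r - ρ)) := (hgeo.mul_left ε).tsum_eq

theorem wSummable_deflate : WSummable r (deflate ρ f) := by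
  have hr : 0 < r := hρ.trans hρr
  have h1 : ∀ n, ∑ k ∈ Finset.range n, |coeff (k + 2) f| * r ^ (k + 2) ≤
      ∑' k, |coeff (k + 2) f| * r ^ (k + 2) := fun n =>
    ((summable_nat_add_iff (f := fun k => |coeff k f| * r ^ k) 2).2 hf).sum_le_tsum _
      fun _ _ => by positivity
  have h2 := summable_of_sum_range_le (fun _ => by positivity)
    (sum_abs_coeff_deflate_le hρ hρr hf hroot h1)
  exact (summable_nat_add_iff 1).1 h2

/-- At a root `ρ` of `f`, the value of `f / (1 - x / ρ)` is `-ρ f'(ρ)`. -/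
theorem evalAt_deflate {Λ : ℝ} (hΛ : HasSum (fun k : ℕ => k * (coeff k f * ρ ^ k)) Λ) :
    evalAt (deflate ρ f) ρ = -Λ := by
  have hr : 0 < r := hρ.trans hρr
  have hg := wSummable_deflate hρ hρr hf hroot
  have h1 := (hg.summable hρ.le hρr.le).hasSum.tendsto_sum_nat
  have h2 := hΛ.tendsto_sum_nat
  have key : ∀ n, ∑ k ∈ Finset.range n, coeff k (deflate ρ f) * ρ ^ k =
      n * (∑ k ∈ Finset.range n, coeff k f * ρ ^ k) -
        ∑ k ∈ Finset.range n, (k : ℝ) * (coeff k f * ρ ^ k) := by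
    intro n
    induction n with
    | zero => simp
    | succ n ih =>
      rw [Finset.sum_range_succ, ih, coeff_deflate hρ, Finset.sum_range_succ _ n,
        Finset.sum_range_succ _ n]
      push_cast
      ring
  have h3 : Tendsto (fun n : ℕ => (n : ℝ) * ∑ k ∈ Finset.range n, coeff k f * ρ ^ k) atTop
      (nhds 0) := by
    rw [← tendsto_add_atTop_iff_nat 1]
    have ht : |ρ / r| < 1 := by
      rw [abs_of_nonneg (by positivity)]
      exact (div_lt_one hr).2 hρr
    have hp := tendsto_self_mul_const_pow_of_abs_lt_one ht
    have hp1 := tendsto_pow_atTop_nhds_zero_of_abs_lt_one ht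
    have hb := hg.tendsto_atTop_zero
    have hprod := hb.mul (hp.add hp1)
    simp only [mul_zero, add_zero] at hprod
    refine squeeze_zero_norm (fun n => le_of_eq ?_) hprod
    rw [← coeff_deflate hρ, Real.norm_eq_abs, abs_mul, abs_mul, abs_of_pos (pow_pos hρ n),
      abs_of_nonneg (by positivity), div_pow]
    push_cast
    field_simp
  have h4 := h3.sub h2
  simp only [← key, zero_sub] at h4
  exact tendsto_nhds_unique h1 h4

end root

/-- If the constant term of `G` dominates, in the weighted `ℓ¹` norm, the rest of `G`, then
dividing by `G` preserves absolute convergence. -/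
theorem WSummable.of_mul_eq {r : ℝ} (hr : 0 < r) {G w M : ℝ⟦X⟧} (h : G * w = M)
    (hM : WSummable r M) {δ : ℝ}
    (hδ : ∀ n, ∑ k ∈ Finset.range n, |coeff (k + 1) G| * r ^ (k + 1) ≤ δ)
    (hlt : δ < |coeff 0 G|) : WSummable r w := by
  set a : ℕ → ℝ := fun k => |coeff (k + 1) G| * r ^ (k + 1) with ha
  set b : ℕ → ℝ := fun k => |coeff k w| * r ^ k with hb
  have ha0 : ∀ k, 0 ≤ a k := fun k => by positivity
  have hb0 : ∀ k, 0 ≤ b k := fun k => by positivity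
  -- Compare coefficients in `G w = M`, then sum over `n`; the convolution is at most `δ` times the
  -- partial sum of `b`, which is absorbed on the left.
  have hstep : ∀ n, |coeff 0 G| * b n ≤ |coeff n M| * r ^ n +
      ∑ i ∈ Finset.range n, a i * b (n - (i + 1)) := by
    intro n
    have h1 : coeff n M = ∑ i ∈ Finset.range n, coeff (i + 1) G * coeff (n - (i + 1)) w +
        coeff 0 G * coeff n w := by
      rw [← h, coeff_mul, Finset.Nat.sum_antidiagonal_eq_sum_range_succ_mk,
        Finset.sum_range_succ', Nat.sub_zero]
    have h2 : coeff 0 G * coeff n w * r ^ n = coeff n M * r ^ n -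
        ∑ i ∈ Finset.range n, (coeff (i + 1) G * r ^ (i + 1)) *
          (coeff (n - (i + 1)) w * r ^ (n - (i + 1))) := by
      rw [h1, add_mul, Finset.sum_mul, eq_sub_iff_add_eq, add_comm]
      congr 1
      refine Finset.sum_congr rfl fun i hi => ?_
      have hi' : i + 1 ≤ n := by simpa using hi
      obtain ⟨d, rfl⟩ := Nat.exists_eq_add_of_le hi'
      rw [Nat.add_sub_cancel_left, pow_add]
      ring
    calc |coeff 0 G| * b n = |coeff 0 G * coeff n w * r ^ n| := by
          rw [abs_mul, abs_mul, abs_of_pos (pow_pos hr n), mul_assoc]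
      _ ≤ |coeff n M * r ^ n| + ∑ i ∈ Finset.range n, |(coeff (i + 1) G * r ^ (i + 1)) *
          (coeff (n - (i + 1)) w * r ^ (n - (i + 1)))| := by
          rw [h2]
          exact (abs_sub _ _).trans (by gcongr; exact Finset.abs_sum_le_sum_abs _ _)
      _ = _ := by
          rw [abs_mul, abs_of_pos (pow_pos hr n)]
          congr 1
          refine Finset.sum_congr rfl fun i _ => ?_
          rw [abs_mul, abs_mul, abs_mul, abs_of_pos (pow_pos hr _), abs_of_pos (pow_pos hr _)]
  have hconv : ∀ n, ∑ m ∈ Finset.range n, ∑ i ∈ Finset.range m, a i * b (m - (i + 1)) ≤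
      δ * ∑ k ∈ Finset.range n, b k := by
    intro n
    calc _ = ∑ i ∈ Finset.range n, ∑ m ∈ Finset.Ico (i + 1) n, a i * b (m - (i + 1)) := by
          refine Finset.sum_comm' fun m i => ?_
          simp only [Finset.mem_range, Finset.mem_Ico]
          omega
      _ ≤ ∑ i ∈ Finset.range n, a i * ∑ k ∈ Finset.range n, b k := by
          refine Finset.sum_le_sum fun i _ => ?_
          rw [← Finset.mul_sum]
          refine mul_le_mul_of_nonneg_left ?_ (ha0 i)
          rw [Finset.sum_Ico_eq_sum_range]
          simp only [Nat.add_sub_cancel_left]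
          exact Finset.sum_le_sum_of_subset_of_nonneg (Finset.range_mono (by omega))
            fun k _ _ => hb0 k
      _ ≤ _ := by
          rw [← Finset.sum_mul]
          exact mul_le_mul_of_nonneg_right (hδ n) (Finset.sum_nonneg fun k _ => hb0 k)
  refine summable_of_sum_range_le (c := (∑' n, |coeff n M| * r ^ n) / (|coeff 0 G| - δ)) hb0
    fun n => ?_
  rw [le_div_iff₀ (sub_pos.2 hlt)]
  have h1 : ∑ m ∈ Finset.range n, |coeff m M| * r ^ m ≤ ∑' n, |coeff n M| * r ^ n :=
    hM.sum_le_tsum _ fun _ _ => by positivity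
  have h2 := Finset.sum_le_sum fun m (_ : m ∈ Finset.range n) => hstep m
  rw [← Finset.mul_sum, Finset.sum_add_distrib] at h2
  have h3 := hconv n
  linarith

theorem WSummable.abs_tsum_nat_add_le {r ρ : ℝ} (hρ : 0 < ρ) (hρr : ρ < r) {w : ℝ⟦X⟧}
    (hws : WSummable r w) (n : ℕ) : |∑' j, coeff (j + (n + 1)) w * ρ ^ (j + (n + 1))| ≤
      (ρ / r) ^ n * ∑' k, |coeff k w| * r ^ k := by
  have hr : 0 < r := hρ.trans hρr
  have h3 : Summable fun j => |coeff (j + (n + 1)) w| * r ^ (j + (n + 1)) :=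
    (summable_nat_add_iff (f := fun k => |coeff k w| * r ^ k) (n + 1)).2 hws
  have hterm : ∀ j, ‖coeff (j + (n + 1)) w * ρ ^ (j + (n + 1))‖ ≤
      (ρ / r) ^ n * (|coeff (j + (n + 1)) w| * r ^ (j + (n + 1))) := by
    intro j
    rw [norm_mul, Real.norm_eq_abs, Real.norm_of_nonneg (by positivity)]
    have : ρ ^ (j + (n + 1)) ≤ (ρ / r) ^ n * r ^ (j + (n + 1)) := by
      rw [show j + (n + 1) = n + (j + 1) by ring, pow_add, pow_add r, ← mul_assoc, ← mul_pow,
        div_mul_cancel₀ _ hr.ne']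
      exact mul_le_mul_of_nonneg_left (pow_le_pow_left₀ hρ.le hρr.le _) (pow_pos hρ n).le
    calc |coeff (j + (n + 1)) w| * ρ ^ (j + (n + 1))
        ≤ |coeff (j + (n + 1)) w| * ((ρ / r) ^ n * r ^ (j + (n + 1))) :=
          mul_le_mul_of_nonneg_left this (abs_nonneg _)
      _ = _ := by ring
  have h4 : ∑' j, |coeff (j + (n + 1)) w| * r ^ (j + (n + 1)) ≤ ∑' k, |coeff k w| * r ^ k := by
    have := Summable.sum_add_tsum_nat_add (n + 1)
      (show Summable fun k => |coeff k w| * r ^ k from hws)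
    have h5 : 0 ≤ ∑ k ∈ Finset.range (n + 1), |coeff k w| * r ^ k :=
      Finset.sum_nonneg fun _ _ => by positivity
    linarith
  calc _ ≤ ∑' j, (ρ / r) ^ n * (|coeff (j + (n + 1)) w| * r ^ (j + (n + 1))) :=
        tsum_of_norm_bounded (h3.mul_left _).hasSum hterm
    _ = (ρ / r) ^ n * ∑' j, (|coeff (j + (n + 1)) w| * r ^ (j + (n + 1))) := tsum_mul_left
    _ ≤ _ := mul_le_mul_of_nonneg_left h4 (by positivity)

/-- Multiplying a series that converges at `r > ρ` by `1 / (1 - x / ρ)` gives coefficients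
`K ρ⁻ⁿ + O(r⁻ⁿ)`. -/
theorem WSummable.abs_coeff_deflate_sub_le {r ρ : ℝ} (hρ : 0 < ρ) (hρr : ρ < r) {w : ℝ⟦X⟧}
    (hws : WSummable r w) (n : ℕ) :
    |coeff n (deflate ρ w) - evalAt w ρ * (ρ⁻¹) ^ n| ≤
      (∑' k, |coeff k w| * r ^ k) * (r⁻¹) ^ n := by
  have hr : 0 < r := hρ.trans hρr
  have hρn : 0 < ρ ^ n := pow_pos hρ n
  have e0 := Summable.sum_add_tsum_nat_add (n + 1) (hws.summable hρ.le hρr.le)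
  have e1 : coeff n (deflate ρ w) * ρ ^ n - evalAt w ρ =
      -∑' j, coeff (j + (n + 1)) w * ρ ^ (j + (n + 1)) := by
    rw [coeff_deflate hρ]
    unfold evalAt
    linarith
  have e2 := hws.abs_tsum_nat_add_le hρ hρr n
  rw [← abs_neg, ← e1] at e2
  have e3 : coeff n (deflate ρ w) - evalAt w ρ * (ρ⁻¹) ^ n =
      (coeff n (deflate ρ w) * ρ ^ n - evalAt w ρ) * (ρ⁻¹) ^ n := by
    rw [sub_mul, mul_assoc, ← mul_pow, mul_inv_cancel₀ hρ.ne', one_pow, mul_one]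
  rw [e3, abs_mul, abs_of_pos (pow_pos (inv_pos.2 hρ) n)]
  calc _ ≤ ((ρ / r) ^ n * ∑' k, |coeff k w| * r ^ k) * (ρ⁻¹) ^ n :=
        mul_le_mul_of_nonneg_right e2 (pow_pos (inv_pos.2 hρ) n).le
    _ = _ := by
      rw [div_pow, inv_pow, inv_pow]
      generalize (∑' k, |coeff k w| * r ^ k) = S
      field_simp

/-- Coefficient asymptotics of `F = N / D` from a simple root `ρ < r` of `D`. The inequality on
`Q D`, which says that it is close to a linear polynomial, replaces a count of the zeros of `D` in
the disc of radius `r`. -/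
theorem isBigO_of_simple_root {r ρ : ℝ} (hρ : 0 < ρ) (hρr : ρ < r) {D N F Q : ℝ⟦X⟧}
    (h : D * F = N) (hD : WSummable r D) (hN : WSummable r N) (hQ : WSummable r Q)
    (hroot : evalAt D ρ = 0) {ε : ℝ}
    (hε : ∀ n, ∑ k ∈ Finset.range n, |coeff (k + 2) (Q * D)| * r ^ (k + 2) ≤ ε)
    (hlt : ε * (ρ / (r - ρ)) < |coeff 0 (Q * D)|) {Λ : ℝ}
    (hΛ : HasSum (fun k : ℕ => k * (coeff k D * ρ ^ k)) Λ) (hΛ0 : Λ ≠ 0) :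
    (fun n : ℕ => coeff n F - -evalAt N ρ / Λ * (ρ⁻¹) ^ n) =O[atTop] fun n : ℕ => (r⁻¹) ^ n := by
  have hr : 0 < r := hρ.trans hρr
  set v := ρ⁻¹ with hv
  -- `w = F · (1 - x / ρ)`: the pole at `ρ` is removed.
  set w : ℝ⟦X⟧ := (1 - PowerSeries.C v * X) * F with hw
  have hone := one_sub_mul_mk_pow v
  have hQD : WSummable r (Q * D) := hQ.mul hr.le hD
  have hQDroot : evalAt (Q * D) ρ = 0 := by
    rw [evalAt_mul hQ hD hρ.le hρr.le, hroot, mul_zero]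
  have hws : WSummable r w := by
    refine WSummable.of_mul_eq hr (G := deflate ρ (Q * D)) (M := Q * N) ?_ (hQ.mul hr.le hN)
      (sum_abs_coeff_deflate_le hρ hρr hQD hQDroot hε) ?_
    · rw [deflate, ← h, hw]
      linear_combination (Q * D * F) * hone
    · convert hlt using 2
      have := coeff_deflate hρ (Q * D) 0
      simpa using this
  have hK : evalAt w ρ = -evalAt N ρ / Λ := by
    have h1 : deflate ρ D * w = N := by
      rw [deflate, ← h, hw]
      linear_combination (D * F) * hone
    have h2 := evalAt_mul (wSummable_deflate hρ hρr hD hroot) hws hρ.le hρr.le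
    rw [h1, evalAt_deflate hρ hρr hD hroot hΛ] at h2
    rw [h2]
    field_simp
  have hF : F = deflate ρ w := by
    rw [deflate, hw]
    linear_combination -F * hone
  refine IsBigO.of_bound (∑' k, |coeff k w| * r ^ k) (Eventually.of_forall fun n => ?_)
  rw [← hK, Real.norm_eq_abs, Real.norm_of_nonneg (by positivity), hF]
  exact hws.abs_coeff_deflate_sub_le hρ hρr n

/-! ### Truncated power series as lists -/

/-- The list `l` holds the coefficients of `f` up to degree `L`. A short list is padded by
zeros, and entries beyond degree `L` are unconstrained. -/
def Rep (L : ℕ) (f : ℤ⟦X⟧) (l : List ℤ) : Prop := ∀ k ≤ L, coeff k f = l.getD k 0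

/-- Coefficientwise sum of two lists. -/
def listAdd : List ℤ → List ℤ → List ℤ
  | [], m => m
  | a :: l, [] => a :: l
  | a :: l, b :: m => (a + b) :: listAdd l m

/-- Multiplication of a list by a constant. -/
def listSMul (c : ℤ) (l : List ℤ) : List ℤ := l.map (c * ·)

/-- Multiplication by `X ^ a`, truncated after degree `L`. -/
def listShift (L a : ℕ) (l : List ℤ) : List ℤ := (List.replicate a 0 ++ l).take (L + 1)

/-- The product of two coefficient lists. -/
def listMul : List ℤ → List ℤ → List ℤ
  | [], _ => []
  | c :: q, l => listAdd (listSMul c l) (0 :: listMul q l)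

theorem getD_listAdd (l m : List ℤ) (k : ℕ) :
    (listAdd l m).getD k 0 = l.getD k 0 + m.getD k 0 := by
  induction l generalizing m k with
  | nil => simp [listAdd]
  | cons a l ih =>
    cases m with
    | nil => simp [listAdd]
    | cons b m =>
      cases k with
      | zero => simp [listAdd]
      | succ k => simpa [listAdd] using ih m k

theorem getD_listSMul (c : ℤ) (l : List ℤ) (k : ℕ) :
    (listSMul c l).getD k 0 = c * l.getD k 0 := by
  induction l generalizing k with
  | nil => simp [listSMul]
  | cons a l ih =>
    cases k with
    | zero => simp [listSMul]
    | succ k => simpa [listSMul] using ih k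

theorem getD_take {L k : ℕ} (hk : k ≤ L) (l : List ℤ) :
    (l.take (L + 1)).getD k 0 = l.getD k 0 := by
  simp [List.getD_eq_getElem?_getD, Nat.lt_succ_of_le hk]

theorem getD_listShift {L k : ℕ} (hk : k ≤ L) (a : ℕ) (l : List ℤ) :
    (listShift L a l).getD k 0 = if a ≤ k then l.getD (k - a) 0 else 0 := by
  rw [listShift, getD_take hk]
  split_ifs with h
  · rw [List.getD_append_right _ _ _ _ (by simpa using h), List.length_replicate]
  · rw [List.getD_append _ _ _ _ (by simpa using h)]
    simp [List.getD_eq_getElem?_getD, not_le.1 h]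

theorem Rep.add {L : ℕ} {f g : ℤ⟦X⟧} {l m : List ℤ} (hf : Rep L f l) (hg : Rep L g m) :
    Rep L (f + g) (listAdd l m) := fun k hk => by
  rw [map_add, getD_listAdd, hf k hk, hg k hk]

theorem Rep.sub {L : ℕ} {f g : ℤ⟦X⟧} {l m : List ℤ} (hf : Rep L f l) (hg : Rep L g m) :
    Rep L (f - g) (listAdd l (listSMul (-1) m)) := fun k hk => by
  rw [map_sub, getD_listAdd, getD_listSMul, hf k hk, hg k hk]
  ring

theorem Rep.X_pow_mul {L : ℕ} {f : ℤ⟦X⟧} {l : List ℤ} (hf : Rep L f l) (a : ℕ) :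
    Rep L (X ^ a * f) (listShift L a l) := fun k hk => by
  rw [coeff_X_pow_mul', getD_listShift hk]
  split_ifs with h
  · exact hf _ (by omega)
  · rfl

theorem rep_zero (L : ℕ) : Rep L 0 [] := fun k _ => by simp

theorem rep_one (L : ℕ) : Rep L 1 [1] := fun k _ => by
  rw [coeff_one]
  cases k <;> simp

theorem rep_neg_one (L : ℕ) : Rep L (-1) [-1] := fun k _ => by
  rw [map_neg, coeff_one]
  cases k <;> simp

theorem rep_mk (L : ℕ) (c : ℕ → ℤ) :
    Rep L (PowerSeries.mk c) ((List.range (L + 1)).map c) := fun k hk => by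
  simp [coeff_mk, List.getD_eq_getElem?_getD, Nat.lt_succ_of_le hk]

/-- The polynomial with the given coefficients, as a power series. -/
noncomputable def ofList : List ℤ → ℤ⟦X⟧
  | [] => 0
  | c :: q => PowerSeries.C c + X * ofList q

theorem rep_ofList_mul {L : ℕ} {f : ℤ⟦X⟧} {l : List ℤ} (hf : Rep L f l) (q : List ℤ) :
    Rep L (ofList q * f) (listMul q l) := by
  induction q with
  | nil => simpa [ofList, listMul] using rep_zero L
  | cons c q ih =>
    intro k hk
    rw [ofList, add_mul, map_add, coeff_C_mul, listMul, getD_listAdd, getD_listSMul, hf k hk,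
      mul_assoc]
    congr 1
    cases k with
    | zero => simp
    | succ k => rw [coeff_succ_X_mul, ih k (by omega), List.getD_cons_succ]

/-! ### The denominators as lists -/

/-- The sequence `den112`, truncated after degree `L`. -/
def list112 (L : ℕ) : ℕ → List ℤ × List ℤ
  | 0 => ([1], [1])
  | k + 1 => match list112 L k with
    | (A, D) => (listAdd A (listSMul (-1) (listShift L (2 * (k + 1)) A)),
        listAdd D (listSMul (-1) (listShift L (k + 1) A)))

/-- The sequence `den221`, truncated after degree `L`. -/
def list221 (L : ℕ) : ℕ → List ℤ
  | 0 => []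
  | k + 1 => match list221 L k with
    | B => listAdd (listShift L (k + 1) [1])
        (listAdd B (listSMul (-1) (listShift L (2 * (k + 1)) B)))

/-- The series `geom d`, truncated after degree `L`. -/
def listGeom (L d : ℕ) : List ℤ := (List.range (L + 1)).map fun n => if d ∣ n then 1 else 0

/-- The sequence `den111`, truncated after degree `L`. -/
def list111 (L : ℕ) : ℕ → List ℤ
  | 0 => [1]
  | k + 1 => match listGeom L (3 * (k + 1)) with
    | G => listAdd (list111 L k) (listSMul (-1) (listShift L (k + 1)
        (listAdd G (listSMul (-1) (listShift L (2 * (k + 1)) G)))))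

/-- The sequence `den123`, truncated after degree `L`. -/
def list123 (L : ℕ) : ℕ → List ℤ × List ℤ × List ℤ
  | 0 => ([1], [], [])
  | k + 1 => match list123 L k with
    | (e, f, g) => (listAdd e (listShift L (k + 1) g), listAdd f (listShift L (k + 1) e),
        listAdd g (listShift L (k + 1) f))

/-- The sequence `zigzag`, truncated after degree `L`, for the initial list `s`. -/
def listZigzag (L : ℕ) (s : List ℤ) : ℕ → List ℤ × List ℤ
  | 0 => ([1], s)
  | k + 1 => match listZigzag L s k with
    | (u, v) => match listAdd u (listShift L (k + 1) v) with
      | u' => (u', listAdd v (listShift L (k + 1) u'))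

theorem rep_den112 (L m : ℕ) :
    Rep L (den112 m).1 (list112 L m).1 ∧ Rep L (den112 m).2 (list112 L m).2 := by
  induction m with
  | zero => exact ⟨rep_one L, rep_one L⟩
  | succ m ih =>
    exact ⟨ih.1.sub (ih.1.X_pow_mul _), ih.2.sub (ih.1.X_pow_mul _)⟩

theorem rep_den221 (L m : ℕ) : Rep L (den221 m) (list221 L m) := by
  induction m with
  | zero => exact rep_zero L
  | succ m ih =>
    have h := (rep_one L).X_pow_mul (m + 1)
    rw [mul_one] at h
    exact h.add (ih.sub (ih.X_pow_mul _))

theorem rep_den111 (L m : ℕ) : Rep L (den111 m) (list111 L m) := by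
  induction m with
  | zero => exact rep_one L
  | succ m ih =>
    have h : Rep L (geom (3 * (m + 1))) (listGeom L (3 * (m + 1))) := rep_mk L _
    exact ih.sub ((h.sub (h.X_pow_mul _)).X_pow_mul _)

theorem rep_den123 (L m : ℕ) : Rep L (den123 m).1 (list123 L m).1 ∧
    Rep L (den123 m).2.1 (list123 L m).2.1 ∧ Rep L (den123 m).2.2 (list123 L m).2.2 := by
  induction m with
  | zero => exact ⟨rep_one L, rep_zero L, rep_zero L⟩
  | succ m ih =>
    exact ⟨ih.1.add (ih.2.2.X_pow_mul _), ih.2.1.add (ih.1.X_pow_mul _),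
      ih.2.2.add (ih.2.1.X_pow_mul _)⟩

theorem rep_zigzag {L : ℕ} {s : ℤ⟦X⟧} {l : List ℤ} (hs : Rep L s l) (m : ℕ) :
    Rep L (zigzag s m).1 (listZigzag L l m).1 ∧ Rep L (zigzag s m).2 (listZigzag L l m).2 := by
  induction m with
  | zero => exact ⟨rep_one L, hs⟩
  | succ m ih =>
    have h := ih.1.add (ih.2.X_pow_mul (m + 1))
    exact ⟨h, ih.2.add (h.X_pow_mul _)⟩

theorem IsStable.rep_stableLim {s : ℕ → ℤ⟦X⟧} (hs : IsStable s) {L : ℕ} {l : List ℤ}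
    (h : Rep L (s L) l) : Rep L (stableLim s) l := fun k hk => by
  rw [hs.coeff_stableLim hk, h k hk]

/-! ### Rigorous enclosures of values of power series -/

/-- An integer power series as a real one. -/
noncomputable def toReal (f : ℤ⟦X⟧) : ℝ⟦X⟧ := PowerSeries.map (Int.castRingHom ℝ) f

@[simp] theorem coeff_toReal (f : ℤ⟦X⟧) (k : ℕ) : coeff k (toReal f) = ((coeff k f : ℤ) : ℝ) := by
  simp [toReal]

theorem toReal_mul (f g : ℤ⟦X⟧) : toReal (f * g) = toReal f * toReal g := map_mul _ _ _

/-- The value at `x` of the polynomial with coefficient list `l`. -/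
noncomputable def horner (x : ℝ) : List ℤ → ℝ
  | [] => 0
  | c :: l => c + x * horner x l

/-- A lower bound on `[x₁, x₂]` of the polynomial with coefficient list `l`, for `0 ≤ x₁ ≤ x₂`. -/
def hornerLo (x₁ x₂ : ℚ) : List ℤ → ℚ
  | [] => 0
  | c :: l => match hornerLo x₁ x₂ l with
    | s => c + (if 0 ≤ s then x₁ * s else x₂ * s)

/-- An upper bound on `[x₁, x₂]` of the polynomial with coefficient list `l`,
for `0 ≤ x₁ ≤ x₂`. -/
def hornerHi (x₁ x₂ : ℚ) : List ℤ → ℚ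
  | [] => 0
  | c :: l => match hornerHi x₁ x₂ l with
    | s => c + (if 0 ≤ s then x₂ * s else x₁ * s)

theorem hornerLo_le {x₁ x₂ : ℚ} {x : ℝ} (h0 : 0 ≤ x₁) (h1 : x₁ ≤ x) (h2 : x ≤ x₂) (l : List ℤ) :
    hornerLo x₁ x₂ l ≤ horner x l := by
  have h0' : (0 : ℝ) ≤ x₁ := by exact_mod_cast h0
  induction l with
  | nil => simp [hornerLo, horner]
  | cons c l ih =>
    rw [hornerLo, horner]
    push_cast
    refine add_le_add_right ?_ _
    have hx : x * (hornerLo x₁ x₂ l : ℝ) ≤ x * horner x l :=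
      mul_le_mul_of_nonneg_left ih (h0'.trans h1)
    refine le_trans ?_ hx
    split_ifs with hs
    · push_cast
      exact mul_le_mul_of_nonneg_right h1 (by exact_mod_cast hs)
    · push_cast
      exact mul_le_mul_of_nonpos_right h2 (by exact_mod_cast (not_le.1 hs).le)

theorem le_hornerHi {x₁ x₂ : ℚ} {x : ℝ} (h0 : 0 ≤ x₁) (h1 : x₁ ≤ x) (h2 : x ≤ x₂) (l : List ℤ) :
    horner x l ≤ hornerHi x₁ x₂ l := by
  have h0' : (0 : ℝ) ≤ x₁ := by exact_mod_cast h0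
  induction l with
  | nil => simp [hornerHi, horner]
  | cons c l ih =>
    rw [hornerHi, horner]
    push_cast
    refine add_le_add_right ?_ _
    have hx : x * horner x l ≤ x * (hornerHi x₁ x₂ l : ℝ) :=
      mul_le_mul_of_nonneg_left ih (h0'.trans h1)
    refine hx.trans ?_
    split_ifs with hs
    · push_cast
      exact mul_le_mul_of_nonneg_right h2 (by exact_mod_cast hs)
    · push_cast
      exact mul_le_mul_of_nonpos_right h1 (by exact_mod_cast (not_le.1 hs).le)

theorem horner_eq_sum (x : ℝ) (l : List ℤ) {n : ℕ} (hn : l.length ≤ n) :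
    horner x l = ∑ k ∈ Finset.range n, (l.getD k 0 : ℝ) * x ^ k := by
  induction l generalizing n with
  | nil => simp [horner]
  | cons c l ih =>
    obtain ⟨n, rfl⟩ : ∃ m, n = m + 1 := ⟨n - 1, by simp at hn; omega⟩
    rw [horner, ih (n := n) (by simpa using hn), Finset.sum_range_succ', Finset.mul_sum, add_comm]
    congr 1
    · refine Finset.sum_congr rfl fun k _ => ?_
      rw [List.getD_cons_succ, pow_succ]
      ring
    · simp

/-- The coefficients of `f` are bounded by `B / Rᵏ`. -/
def CoeffBound (B R : ℝ) (f : ℤ⟦X⟧) : Prop := ∀ k, |((coeff k f : ℤ) : ℝ)| * R ^ k ≤ B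

section CoeffBound

variable {B R : ℝ} {f : ℤ⟦X⟧}

theorem CoeffBound.abs_mul_pow_le (hR : 0 < R) (hf : CoeffBound B R f) {x : ℝ} (hx : 0 ≤ x)
    (k : ℕ) : |((coeff k f : ℤ) : ℝ)| * x ^ k ≤ B * (x / R) ^ k := by
  have h := mul_le_mul_of_nonneg_right (hf k) (pow_nonneg (div_nonneg hx hR.le) k)
  rwa [mul_assoc, ← mul_pow, mul_div_cancel₀ _ hR.ne'] at h

theorem CoeffBound.wSummable (hR : 0 < R) (hf : CoeffBound B R f) {r : ℝ} (hr : 0 ≤ r)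
    (hrR : r < R) : WSummable r (toReal f) := by
  refine Summable.of_nonneg_of_le (fun k => by positivity) (fun k => ?_)
    ((summable_geometric_of_lt_one (div_nonneg hr hR.le) ((div_lt_one hR).2 hrR)).mul_left B)
  rw [coeff_toReal]
  exact hf.abs_mul_pow_le hR hr k

/-- The error of truncating a series bounded by `B / Rᵏ` after degree `L`. -/
def tailBound (B R x : ℚ) (L : ℕ) : ℚ := B * (x / R) ^ (L + 1) / (1 - x / R)

theorem CoeffBound.abs_evalAt_sub_horner_le {B R : ℚ} (hR : 0 < R) (hf : CoeffBound B R f) {L : ℕ}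
    {l : List ℤ} (hl : Rep L f l) {x : ℝ} (hx : 0 ≤ x) {x₂ : ℚ} (hx₂ : x ≤ x₂) (hxR : x₂ < R) :
    |evalAt (toReal f) x - horner x (l.take (L + 1))| ≤ tailBound B R x₂ L := by
  have hR' : (0 : ℝ) < R := by exact_mod_cast hR
  have hxR' : (x₂ : ℝ) < R := by exact_mod_cast hxR
  have hs := hf.wSummable hR' hx (hx₂.trans_lt hxR')
  have h1 := Summable.sum_add_tsum_nat_add (L + 1) (hs.summable hx le_rfl)
  have h2 : horner x (l.take (L + 1)) =
      ∑ k ∈ Finset.range (L + 1), coeff k (toReal f) * x ^ k := by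
    rw [horner_eq_sum x _ (n := L + 1) (by simp)]
    refine Finset.sum_congr rfl fun k hk => ?_
    have hk' : k ≤ L := by simpa [Nat.lt_succ_iff] using hk
    rw [coeff_toReal, getD_take hk', hl k hk']
  have h3 : evalAt (toReal f) x - horner x (l.take (L + 1)) =
      ∑' k, coeff (k + (L + 1)) (toReal f) * x ^ (k + (L + 1)) := by
    rw [h2, evalAt, ← h1]
    ring
  have hx₂0 : (0 : ℝ) ≤ x₂ := hx.trans hx₂
  have hB : (0 : ℝ) ≤ B := le_trans (by positivity) (hf 0)
  have hq1 : (x₂ / R : ℝ) < 1 := (div_lt_one hR').2 hxR'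
  have hg := (hasSum_geometric_of_lt_one (div_nonneg hx₂0 hR'.le) hq1).mul_left
    (B * (x₂ / R : ℝ) ^ (L + 1))
  rw [h3, tailBound]
  push_cast
  rw [div_eq_mul_inv _ (1 - (x₂ / R : ℝ))]
  rw [← Real.norm_eq_abs]
  refine tsum_of_norm_bounded hg fun k => ?_
  rw [norm_mul, Real.norm_eq_abs, Real.norm_of_nonneg (by positivity), coeff_toReal, mul_assoc,
    ← pow_add, add_comm (L + 1) k]
  refine (hf.abs_mul_pow_le hR' hx _).trans ?_
  gcongr

theorem continuousOn_evalAt {f : ℝ⟦X⟧} {r : ℝ} (hf : WSummable r f) :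
    ContinuousOn (evalAt f) (Set.Icc 0 r) := by
  refine continuousOn_tsum (u := fun k => |coeff k f| * r ^ k) (fun k => by fun_prop) hf ?_
  rintro k x ⟨hx0, hxr⟩
  rw [norm_mul, Real.norm_eq_abs, Real.norm_of_nonneg (by positivity)]
  gcongr

end CoeffBound

/-- The series `∑ k fₖ xᵏ`. -/
noncomputable def eulerDeriv (f : ℤ⟦X⟧) : ℤ⟦X⟧ := PowerSeries.mk fun k => k * coeff k f

/-- The coefficient list of `eulerDeriv`, for a list that starts in degree `n`. -/
def listEulerDeriv : ℕ → List ℤ → List ℤ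
  | _, [] => []
  | n, c :: l => n * c :: listEulerDeriv (n + 1) l

theorem getD_listEulerDeriv (n : ℕ) (l : List ℤ) (k : ℕ) :
    (listEulerDeriv n l).getD k 0 = (n + k : ℕ) * l.getD k 0 := by
  induction l generalizing n k with
  | nil => simp [listEulerDeriv]
  | cons c l ih =>
    cases k with
    | zero => simp [listEulerDeriv]
    | succ k =>
      rw [listEulerDeriv, List.getD_cons_succ, List.getD_cons_succ, ih, add_right_comm, add_assoc]

theorem Rep.eulerDeriv {L : ℕ} {f : ℤ⟦X⟧} {l : List ℤ} (h : Rep L f l) :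
    Rep L (eulerDeriv f) (listEulerDeriv 0 l) := fun k hk => by
  rw [CompPattern.eulerDeriv, coeff_mk, getD_listEulerDeriv, zero_add, h k hk]

/-- By Bernoulli's inequality `k ≤ 32 (33/32)ᵏ`, so a factor `k` costs a slightly smaller radius. -/
theorem CoeffBound.eulerDeriv {B R : ℝ} (hR : 0 ≤ R) {f : ℤ⟦X⟧} (h : CoeffBound B R f) :
    CoeffBound (32 * B) (R * (32 / 33)) (eulerDeriv f) := fun k => by
  have hb := one_add_mul_le_pow (show (-2 : ℝ) ≤ 1 / 32 by norm_num) k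
  have hk : (k : ℝ) * (32 / 33) ^ k ≤ 32 := by
    have e : ((1 : ℝ) + 1 / 32) ^ k * (32 / 33) ^ k = 1 := by
      rw [← mul_pow]; norm_num
    have hp : (0 : ℝ) < (32 / 33) ^ k := by positivity
    nlinarith
  have hB : 0 ≤ B := le_trans (by positivity) (h 0)
  rw [CompPattern.eulerDeriv, coeff_mk, mul_pow]
  push_cast
  rw [abs_mul, Nat.abs_cast]
  calc (k : ℝ) * |((coeff k f : ℤ) : ℝ)| * (R ^ k * (32 / 33) ^ k)
      = (k * (32 / 33) ^ k) * (|((coeff k f : ℤ) : ℝ)| * R ^ k) := by ring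
    _ ≤ 32 * B := mul_le_mul hk (h k) (by positivity) (by norm_num)

/-- The series `∑_{k ≥ 2} |fₖ| xᵏ`. -/
noncomputable def absTail (f : ℤ⟦X⟧) : ℤ⟦X⟧ :=
  PowerSeries.mk fun k => if k < 2 then 0 else |coeff k f|

/-- The coefficient list of `absTail`. -/
def listAbsTail : List ℤ → List ℤ
  | _ :: _ :: l => 0 :: 0 :: l.map abs
  | _ => []

theorem Rep.absTail {L : ℕ} {f : ℤ⟦X⟧} {l : List ℤ} (h : Rep L f l) :
    Rep L (absTail f) (listAbsTail l) := fun k hk => by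
  rw [CompPattern.absTail, coeff_mk, h k hk]
  match l, k with
  | [], _ => simp [listAbsTail]
  | [_], 0 => simp [listAbsTail]
  | [_], k + 1 => simp [listAbsTail]
  | _ :: _ :: _, 0 => simp [listAbsTail]
  | _ :: _ :: _, 1 => simp [listAbsTail]
  | _ :: _ :: l, k + 2 =>
    simp only [listAbsTail, List.getD_cons_succ]
    rw [if_neg (by omega), ← abs_zero (α := ℤ), List.getD_map, abs_zero]

theorem CoeffBound.absTail {B R : ℝ} {f : ℤ⟦X⟧} (h : CoeffBound B R f) :
    CoeffBound B R (absTail f) := fun k => by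
  rw [CompPattern.absTail, coeff_mk]
  split_ifs with hk
  · simpa using le_trans (by positivity) (h 0)
  · simpa using h k

theorem CoeffBound.ofList_mul {B R : ℝ} (hR : 0 ≤ R) {f : ℤ⟦X⟧} (h : CoeffBound B R f)
    (q : List ℤ) : CoeffBound (B * horner R (q.map abs)) R (ofList q * f) := by
  have hB : 0 ≤ B := le_trans (by positivity) (h 0)
  induction q with
  | nil => intro k; simp [ofList, horner]
  | cons c q ih =>
    intro k
    have h1 : |((coeff k (PowerSeries.C c * f) : ℤ) : ℝ)| * R ^ k ≤ |(c : ℝ)| * B := by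
      rw [coeff_C_mul, Int.cast_mul, abs_mul, mul_assoc]
      exact mul_le_mul_of_nonneg_left (h k) (abs_nonneg _)
    have h2 : |((coeff k (X * (ofList q * f)) : ℤ) : ℝ)| * R ^ k ≤
        R * (B * horner R (q.map abs)) := by
      cases k with
      | zero =>
        simp only [coeff_zero_X_mul, Int.cast_zero, abs_zero, zero_mul]
        exact mul_nonneg hR (le_trans (by positivity) (ih 0))
      | succ k =>
        rw [coeff_succ_X_mul, pow_succ', mul_left_comm]
        exact mul_le_mul_of_nonneg_left (ih k) hR
    rw [ofList, add_mul, mul_assoc, map_add, Int.cast_add, List.map_cons, horner, Int.cast_abs]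
    calc _ ≤ (|((coeff k (PowerSeries.C c * f) : ℤ) : ℝ)| +
          |((coeff k (X * (ofList q * f)) : ℤ) : ℝ)|) * R ^ k := by
          gcongr
          exact abs_add_le _ _
      _ ≤ _ := by
          rw [add_mul]
          linarith

/-- The rational inequalities that yield the asymptotics for a denominator and a numerator with
coefficient lists `d` and `n` up to degree `L` and all coefficients bounded by `B (20/17)ᵏ`:
* the enclosure `[x₁, x₂]` of the root lies in `(0, 7/10)`, and its reciprocals are within `tv`
  of `v₀`;
* the denominator changes sign between `x₁` and `x₂`, with the truncation error `t` accounted for;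
* `-N(ρ) / (ρ D'(ρ))` is within `tK` of `K₀` for every `ρ ∈ [x₁, x₂]`, where the truncation error
  `t'` of `ρ D'(ρ)` uses the constants of `CoeffBound.eulerDeriv`, `136/165 = 17/20 · 32/33`;
* with the multiplier `q`, the product `q d` is dominated by its constant term in the sense of
  `isBigO_of_simple_root` with `r = 7/10`. -/
def Certificate (L : ℕ) (B : ℚ) (d n q : List ℤ) (x₁ x₂ K₀ tK v₀ tv : ℚ) : Prop :=
  (0 < x₁ ∧ x₁ ≤ x₂ ∧ x₂ < 7 / 10) ∧
  (v₀ - tv < 1 / x₂ ∧ 1 / x₁ < v₀ + tv ∧ tK ≤ K₀) ∧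
  (match tailBound B (17 / 20) x₂ L, d.take (L + 1), n.take (L + 1) with
    | t, d, n => (t < hornerLo x₁ x₁ d ∧ hornerHi x₂ x₂ d < -t) ∧
    (match tailBound (32 * B) (136 / 165) x₂ L, (listEulerDeriv 0 d).take (L + 1) with
      | t', d' => hornerHi x₁ x₂ d' + t' < 0 ∧
        (K₀ - tK) * (t' - hornerLo x₁ x₂ d') < hornerLo x₁ x₂ n - t ∧
        hornerHi x₁ x₂ n + t < (K₀ + tK) * (-(hornerHi x₁ x₂ d' + t')))) ∧
  (match listMul q d with
    | e => (hornerHi (7 / 10) (7 / 10) ((listAbsTail e).take (L + 1)) +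
        tailBound (B * hornerHi (17 / 20) (17 / 20) (q.map abs)) (17 / 20) (7 / 10) L) *
          (x₂ / (7 / 10 - x₂)) < |e.getD 0 0|)

instance (L : ℕ) (B : ℚ) (d n q : List ℤ) (x₁ x₂ K₀ tK v₀ tv : ℚ) :
    Decidable (Certificate L B d n q x₁ x₂ K₀ tK v₀ tv) := by
  unfold Certificate
  infer_instance

/-! ### Asymptotics from a certificate -/

/-- A valid certificate proves the asymptotics. -/
theorem isBigO_of_certificate {P : Finset Word3} {D N : ℤ⟦X⟧} (h : D * avoidGF P = N) {L : ℕ}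
    {B : ℚ} {d n q : List ℤ} (hd : Rep L D d) (hn : Rep L N n) (hD : CoeffBound B (17 / 20) D)
    (hN : CoeffBound B (17 / 20) N) {x₁ x₂ K₀ tK v₀ tv : ℚ}
    (hc : Certificate L B d n q x₁ x₂ K₀ tK v₀ tv) :
    ∃ K v : ℝ, |K - K₀| < tK ∧ |v - v₀| < tv ∧
      (fun n : ℕ => (compCount P n 0 : ℝ) - K * v ^ n) =O[atTop] fun n : ℕ => (10 / 7 : ℝ) ^ n := by
  obtain ⟨⟨hx₁, hx₁₂, hx₂⟩, ⟨hv₂, hv₁, htK⟩, ⟨⟨hpos, hneg⟩, hΛneg, hKlo, hKhi⟩, hQ⟩ := hc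
  set t := tailBound B (17 / 20) x₂ L with ht
  set t' := tailBound (32 * B) (136 / 165) x₂ L with ht'
  have hB : (0 : ℝ) ≤ B := le_trans (by positivity) (hD 0)
  have hx₁r : (0 : ℝ) < x₁ := by exact_mod_cast hx₁
  have hx₁₂r : (x₁ : ℝ) ≤ x₂ := by exact_mod_cast hx₁₂
  have hx₂r : (x₂ : ℝ) < 7 / 10 := by
    have : ((x₂ : ℚ) : ℝ) < ((7 / 10 : ℚ) : ℝ) := by exact_mod_cast hx₂
    simpa using this
  have cast_R : ((17 / 20 : ℚ) : ℝ) = 17 / 20 := by norm_num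
  have hDq : CoeffBound B ((17 / 20 : ℚ) : ℝ) D := by rwa [cast_R]
  have hNq : CoeffBound B ((17 / 20 : ℚ) : ℝ) N := by rwa [cast_R]
  have hDs : WSummable (7 / 10) (toReal D) := hD.wSummable (by norm_num) (by norm_num) (by norm_num)
  have hNs : WSummable (7 / 10) (toReal N) := hN.wSummable (by norm_num) (by norm_num) (by norm_num)
  have hR0 : (0 : ℚ) < 17 / 20 := by norm_num
  have hx₂R : x₂ < 17 / 20 := hx₂.trans (by norm_num)
  have hDerr : ∀ x : ℝ, 0 ≤ x → x ≤ x₂ →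
      |evalAt (toReal D) x - horner x (d.take (L + 1))| ≤ t := fun x h0 h2 =>
    hDq.abs_evalAt_sub_horner_le hR0 hd h0 h2 hx₂R
  -- A root of `D` between `x₁` and `x₂`.
  obtain ⟨ρ, ⟨hρ₁, hρ₂⟩, hroot⟩ : ∃ ρ ∈ Set.Icc (x₁ : ℝ) x₂, evalAt (toReal D) ρ = 0 := by
    have hcont : ContinuousOn (evalAt (toReal D)) (Set.Icc (x₁ : ℝ) x₂) :=
      (continuousOn_evalAt hDs).mono (Set.Icc_subset_Icc hx₁r.le hx₂r.le)
    refine intermediate_value_Icc' hx₁₂r hcont ⟨?_, ?_⟩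
    · have h1 := (abs_le.1 (hDerr x₂ (hx₁r.le.trans hx₁₂r) le_rfl)).2
      have h2 := le_hornerHi (hx₁.le.trans hx₁₂) (le_refl (x₂ : ℝ)) (le_refl (x₂ : ℝ))
        (d.take (L + 1))
      have h3 : ((hornerHi x₂ x₂ (d.take (L + 1)) : ℚ) : ℝ) < ((-t : ℚ) : ℝ) := by
        exact_mod_cast hneg
      push_cast at h3
      linarith
    · have h1 := (abs_le.1 (hDerr x₁ hx₁r.le hx₁₂r)).1
      have h2 := hornerLo_le hx₁.le (le_refl (x₁ : ℝ)) (le_refl (x₁ : ℝ)) (d.take (L + 1))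
      have h3 : (t : ℝ) < ((hornerLo x₁ x₁ (d.take (L + 1)) : ℚ) : ℝ) := by exact_mod_cast hpos
      linarith
  have hρ0 : 0 < ρ := hx₁r.trans_le hρ₁
  have hρr : ρ < 7 / 10 := hρ₂.trans_lt hx₂r
  -- The derivative and the numerator at the root.
  set Λ := evalAt (toReal (eulerDeriv D)) ρ with hΛdef
  have hder : CoeffBound ((32 * B : ℚ) : ℝ) ((136 / 165 : ℚ) : ℝ) (eulerDeriv D) := by
    have := hD.eulerDeriv (by norm_num)
    convert this using 1 <;> norm_num
  have hd' : Rep L (eulerDeriv D) (listEulerDeriv 0 (d.take (L + 1))) :=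
    Rep.eulerDeriv fun k hk => by rw [getD_take hk, hd k hk]
  have hΛerr := hder.abs_evalAt_sub_horner_le (by norm_num) hd' hρ0.le hρ₂
    (hx₂.trans (by norm_num))
  rw [← hΛdef, ← ht'] at hΛerr
  have hNerr := hNq.abs_evalAt_sub_horner_le hR0 hn hρ0.le hρ₂ hx₂R
  rw [← ht] at hNerr
  have hΛlo := hornerLo_le hx₁.le hρ₁ hρ₂ ((listEulerDeriv 0 (d.take (L + 1))).take (L + 1))
  have hΛhi := le_hornerHi hx₁.le hρ₁ hρ₂ ((listEulerDeriv 0 (d.take (L + 1))).take (L + 1))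
  have hNlo := hornerLo_le hx₁.le hρ₁ hρ₂ (n.take (L + 1))
  have hNhi := le_hornerHi hx₁.le hρ₁ hρ₂ (n.take (L + 1))
  rw [abs_le] at hΛerr hNerr
  have hΛneg' : ((hornerHi x₁ x₂ ((listEulerDeriv 0 (d.take (L + 1))).take (L + 1)) + t' : ℚ) : ℝ)
      < 0 := by exact_mod_cast hΛneg
  have hKlo' := (Rat.cast_lt (K := ℝ)).2 hKlo
  have hKhi' := (Rat.cast_lt (K := ℝ)).2 hKhi
  push_cast at hΛneg' hKlo' hKhi'
  have hΛ0 : Λ < 0 := by linarith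
  have hΛsum : HasSum (fun k : ℕ => k * (coeff k (toReal D) * ρ ^ k)) Λ := by
    have hs : WSummable (7 / 10) (toReal (eulerDeriv D)) :=
      hder.wSummable (by norm_num) (by norm_num) (by norm_num)
    have hfun : (fun k : ℕ => (k : ℝ) * (coeff k (toReal D) * ρ ^ k)) =
        fun k => coeff k (toReal (eulerDeriv D)) * ρ ^ k := by
      funext k
      rw [coeff_toReal, coeff_toReal, eulerDeriv, coeff_mk]
      push_cast
      ring
    rw [hfun]
    exact (hs.summable hρ0.le hρr.le).hasSum
  -- Away from its first two coefficients, `Q D` is small in norm.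
  set E := ofList q * D with hE
  have hErep : Rep L E (listMul q d) := rep_ofList_mul hd q
  set S := hornerHi (17 / 20) (17 / 20) (q.map abs) with hS
  have hEb : CoeffBound ((B * S : ℚ) : ℝ) ((17 / 20 : ℚ) : ℝ) E := by
    intro k
    refine ((hDq.ofList_mul (by norm_num) q) k).trans ?_
    push_cast
    refine mul_le_mul_of_nonneg_left ?_ hB
    exact le_hornerHi (by norm_num) (by norm_num) (by norm_num) _
  set ε := hornerHi (7 / 10) (7 / 10) ((listAbsTail (listMul q d)).take (L + 1)) +
    tailBound (B * S) (17 / 20) (7 / 10) L with hε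
  have htail : evalAt (toReal (absTail E)) (7 / 10) ≤ ε := by
    have h1 := hEb.absTail.abs_evalAt_sub_horner_le (by norm_num) hErep.absTail
      (x := 7 / 10) (by norm_num) (x₂ := 7 / 10) (by norm_num) (by norm_num)
    have h2 := le_hornerHi (x₁ := 7 / 10) (x₂ := 7 / 10) (x := 7 / 10) (by norm_num) (by norm_num)
      (by norm_num) ((listAbsTail (listMul q d)).take (L + 1))
    have h3 := (abs_le.1 h1).2
    rw [hε, Rat.cast_add]
    linarith
  have hEpart : ∀ m, ∑ k ∈ Finset.range m,
      |coeff (k + 2) (toReal (ofList q) * toReal D)| * (7 / 10) ^ (k + 2) ≤ (ε : ℝ) := by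
    intro m
    refine le_trans ?_ htail
    have hs : WSummable (7 / 10) (toReal (absTail E)) :=
      hEb.absTail.wSummable (by norm_num) (by norm_num) (by norm_num)
    have hterm : ∀ k, 0 ≤ coeff k (toReal (absTail E)) * (7 / 10) ^ k := by
      intro k
      rw [coeff_toReal, absTail, coeff_mk]
      split_ifs
      · simp
      · positivity
    have hle := (hs.summable (by norm_num) le_rfl).sum_le_tsum (Finset.range (m + 2))
      fun k _ => hterm k
    refine le_trans ?_ hle
    rw [add_comm m 2, Finset.sum_range_add]
    refine le_add_of_nonneg_of_le (Finset.sum_nonneg fun k _ => hterm k) (le_of_eq ?_)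
    refine Finset.sum_congr rfl fun k _ => ?_
    rw [← toReal_mul, coeff_toReal, coeff_toReal, absTail, coeff_mk, if_neg (by omega),
      add_comm 2 k, Int.cast_abs]
  have hE0 : coeff 0 (toReal (ofList q) * toReal D) = (((listMul q d).getD 0 0 : ℤ) : ℝ) := by
    rw [← toReal_mul, coeff_toReal, ← hErep 0 (Nat.zero_le _)]
  have hlt : (ε : ℝ) * (ρ / (7 / 10 - ρ)) < |coeff 0 (toReal (ofList q) * toReal D)| := by
    have h1 := (Rat.cast_lt (K := ℝ)).2 hQ
    rw [hE0, ← Int.cast_abs]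
    refine lt_of_le_of_lt ?_ (by simpa using h1)
    have hε0 : (0 : ℝ) ≤ ε := by simpa using hEpart 0
    have hsub : (0 : ℝ) < 7 / 10 - x₂ := sub_pos.2 hx₂r
    rw [hε] at hε0 ⊢
    push_cast at hε0 ⊢
    refine mul_le_mul_of_nonneg_left ?_ hε0
    exact div_le_div₀ (hρ0.le.trans hρ₂) hρ₂ hsub (by linarith)
  have hQs : WSummable (7 / 10) (toReal (ofList q)) := by
    have h1 : CoeffBound 1 (17 / 20) 1 := by
      intro k
      rw [coeff_one]
      split_ifs with hk
      · simp [hk]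
      · simp
    have h2 := h1.ofList_mul (by norm_num) q
    rw [mul_one] at h2
    exact h2.wSummable (by norm_num) (by norm_num) (by norm_num)
  have hmain := isBigO_of_simple_root hρ0 hρr (F := toReal (avoidGF P))
    (by rw [← toReal_mul, h]) hDs hNs hQs hroot hEpart hlt hΛsum hΛ0.ne
  refine ⟨-evalAt (toReal N) ρ / Λ, ρ⁻¹, ?_, ?_, ?_⟩
  · have hK0 : (0 : ℝ) ≤ K₀ - tK := sub_nonneg.2 (by exact_mod_cast htK)
    have hKp : (0 : ℝ) ≤ K₀ + tK := by
      by_contra hcon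
      nlinarith
    rw [abs_sub_lt_iff, neg_div, ← div_neg, sub_lt_iff_lt_add, sub_lt_comm,
      lt_div_iff₀ (by linarith), div_lt_iff₀ (by linarith)]
    constructor
    · nlinarith
    · nlinarith
  · have h1 := (Rat.cast_lt (K := ℝ)).2 hv₁
    have h2 := (Rat.cast_lt (K := ℝ)).2 hv₂
    push_cast at h1 h2
    have h3 : ρ⁻¹ ≤ 1 / x₁ := by rw [one_div]; exact inv_anti₀ hx₁r hρ₁
    have h4 : 1 / (x₂ : ℝ) ≤ ρ⁻¹ := by rw [one_div]; exact inv_anti₀ hρ0 hρ₂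
    rw [abs_sub_lt_iff]
    constructor <;> linarith
  · convert hmain using 2 with n n
    · simp [avoidGF]
    · norm_num

/-! ### The six patterns -/

theorem CoeffBound.stableLim {s : ℕ → ℤ⟦X⟧} (h : ∀ n m, partialNorm (17 / 20) n (s m) ≤ 8200) :
    CoeffBound ((8200 : ℚ) : ℝ) (17 / 20) (stableLim s) := fun n => by
  rw [CompPattern.stableLim, coeff_mk]
  exact ((abs_coeff_mul_le_partialNorm (by norm_num) n (s n)).trans (h _ n)).trans (by norm_num)

theorem CoeffBound.one : CoeffBound ((8200 : ℚ) : ℝ) (17 / 20) 1 := by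
  rw [← stableLim_const 1]
  refine CoeffBound.stableLim fun n _ => ?_
  exact (partialNorm_one_le n).trans (by norm_num)

/-! The root enclosures have length `10⁻⁸`, and the multiplier lists are the first coefficients of
`(1 - x / ρ) / D(x)`, scaled by `64` and rounded. -/

theorem certificate_111 : Certificate 100 8200 (list111 100 100) [1]
    [64, -58, 6, -53, 81, -24, -54, 9, 71] (523350884 / 10 ^ 9) (523350894 / 10 ^ 9)
    0.499301 0.0000005 1.91076 0.000005 := by
  decide +kernel

theorem certificate_112 : Certificate 100 8200 (list112 100 100).2 [1]
    [64, -52, 12, 25, -15, 23, 33, -23, 19, 68, -37] (553439697 / 10 ^ 9) (553439707 / 10 ^ 9)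
    0.692005 0.0000005 1.80688 0.000005 := by
  decide +kernel

theorem certificate_221 : Certificate 100 8200 (listAdd [1] (listSMul (-1) (list221 100 100))) [1]
    [64, -61, 3, 7, 13, -37, 50, -28, 2] (513387281 / 10 ^ 9) (513387291 / 10 ^ 9)
    0.545362 0.0000005 1.94785 0.000005 := by
  decide +kernel

theorem certificate_123 : Certificate 100 8200
    (listAdd (list123 100 100).1 (listSMul (-1) (list123 100 100).2.1)) [1]
    [64, -61, 3, 7, 13, 27, -11, 39, 10] (513285834 / 10 ^ 9) (513285844 / 10 ^ 9)
    0.576096 0.0000005 1.94823 0.000005 := by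
  decide +kernel

theorem certificate_peak : Certificate 100 8200
    (listAdd (listZigzag 100 [] 100).1 (listSMul (-1) (listZigzag 100 [] 100).2))
    (listZigzag 100 [] 100).1
    [64, -40, 24, -17, 7, -10, -2] (613590020 / 10 ^ 9) (613590030 / 10 ^ 9)
    1.39456 0.000005 1.62975 0.000005 := by
  decide +kernel

theorem certificate_valley : Certificate 100 8200
    (listZigzag 100 [-1] 100).1 (listZigzag 100 [] 100).1
    [64, -54, 10, -44, 31, -67, 38, -63, 26, -63, 83] (543206928 / 10 ^ 9) (543206938 / 10 ^ 9)
    0.728207 0.0000005 1.84092 0.000005 := by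
  decide +kernel

theorem asymptotics_pat111 : ∃ K v : ℝ, |K - (0.499301 : ℚ)| < (0.0000005 : ℚ) ∧
    |v - (1.91076 : ℚ)| < (0.000005 : ℚ) ∧
    (fun n : ℕ => (compCount pat111 n 0 : ℝ) - K * v ^ n) =O[atTop]
      fun n : ℕ => (10 / 7 : ℝ) ^ n := by
  refine isBigO_of_certificate (N := 1) ?_ (isStable_den111.rep_stableLim (rep_den111 100 100))
    (rep_one 100) (CoeffBound.stableLim fun n m => ?_) CoeffBound.one certificate_111
  · rw [isStable_den111.stableLim_mul_avoidGF (isStable_const 1) den111_mul, stableLim_const]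
  · have h := partialNorm_den111_le n m
    have : (0 : ℝ) < (17 / 20) ^ m := by positivity
    linarith

theorem asymptotics_pat112 : ∃ K v : ℝ, |K - (0.692005 : ℚ)| < (0.0000005 : ℚ) ∧
    |v - (1.80688 : ℚ)| < (0.000005 : ℚ) ∧
    (fun n : ℕ => (compCount pat112 n 0 : ℝ) - K * v ^ n) =O[atTop]
      fun n : ℕ => (10 / 7 : ℝ) ^ n := by
  refine isBigO_of_certificate (N := 1) ?_
    (isStable_den112.rep_stableLim (rep_den112 100 100).2)
    (rep_one 100) (CoeffBound.stableLim fun n m => ?_) CoeffBound.one certificate_112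
  · rw [isStable_den112.stableLim_mul_avoidGF (isStable_const 1) den112_mul, stableLim_const]
  · have h := (partialNorm_den112_le (R := 17 / 20) (by norm_num) n m).2
    linarith [growth_le m]

theorem asymptotics_pat221 : ∃ K v : ℝ, |K - (0.545362 : ℚ)| < (0.0000005 : ℚ) ∧
    |v - (1.94785 : ℚ)| < (0.000005 : ℚ) ∧
    (fun n : ℕ => (compCount pat221 n 0 : ℝ) - K * v ^ n) =O[atTop]
      fun n : ℕ => (10 / 7 : ℝ) ^ n := by
  refine isBigO_of_certificate (N := 1) ?_
    (isStable_den221.rep_stableLim ((rep_one 100).sub (rep_den221 100 100)))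
    (rep_one 100) (CoeffBound.stableLim fun n m => ?_) CoeffBound.one certificate_221
  · rw [isStable_den221.stableLim_mul_avoidGF (isStable_const 1) den221_mul, stableLim_const]
  · have h := partialNorm_den221_le (R := 17 / 20) (by norm_num) n m
    have h1 := partialNorm_sub_le (R := 17 / 20) (by norm_num) n 1 (den221 m)
    have h2 := partialNorm_one_le (R := 17 / 20) n
    linarith [growth_le m]

theorem asymptotics_pat123 : ∃ K v : ℝ, |K - (0.576096 : ℚ)| < (0.0000005 : ℚ) ∧
    |v - (1.94823 : ℚ)| < (0.000005 : ℚ) ∧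
    (fun n : ℕ => (compCount pat123 n 0 : ℝ) - K * v ^ n) =O[atTop]
      fun n : ℕ => (10 / 7 : ℝ) ^ n := by
  refine isBigO_of_certificate (N := 1) ?_
    (isStable_den123.rep_stableLim ((rep_den123 100 100).1.sub (rep_den123 100 100).2.1))
    (rep_one 100) (CoeffBound.stableLim fun n m => ?_) CoeffBound.one certificate_123
  · rw [isStable_den123.stableLim_mul_avoidGF (isStable_const 1) den123_mul, stableLim_const]
  · have h := partialNorm_den123_le (R := 17 / 20) (by norm_num) n m
    have h1 := partialNorm_sub_le (R := 17 / 20) (by norm_num) n (den123 m).1 (den123 m).2.1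
    linarith [growth_le m, h.1, h.2.1]

theorem partialNorm_zigzag_zero_le (n m : ℕ) : partialNorm (17 / 20) n (zigzag 0 m).1 ≤ 4100 ∧
    partialNorm (17 / 20) n (zigzag 0 m).2 ≤ 4100 := by
  have h0 : partialNorm (17 / 20) n 0 ≤ 1 := by simp [partialNorm]
  have h := partialNorm_zigzag_le (R := 17 / 20) (by norm_num) n m h0
  exact ⟨h.1.trans (growth_le m), h.2.trans (growth_le m)⟩

theorem asymptotics_peak : ∃ K v : ℝ, |K - (1.39456 : ℚ)| < (0.000005 : ℚ) ∧
    |v - (1.62975 : ℚ)| < (0.000005 : ℚ) ∧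
    (fun n : ℕ => (compCount peak n 0 : ℝ) - K * v ^ n) =O[atTop]
      fun n : ℕ => (10 / 7 : ℝ) ^ n := by
  have hs := (isStable_zigzag_fst 0).sub (isStable_zigzag_snd 0)
  have hr := rep_zigzag (rep_zero 100) 100
  refine isBigO_of_certificate
    (hs.stableLim_mul_avoidGF (isStable_zigzag_fst 0) zigzag_peak_mul)
    (hs.rep_stableLim (hr.1.sub hr.2)) ((isStable_zigzag_fst 0).rep_stableLim hr.1)
    (CoeffBound.stableLim fun n m => ?_) (CoeffBound.stableLim fun n m => ?_) certificate_peak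
  · have h := partialNorm_zigzag_zero_le n m
    have h1 := partialNorm_sub_le (R := 17 / 20) (by norm_num) n (zigzag 0 m).1 (zigzag 0 m).2
    linarith [h.1, h.2]
  · linarith [(partialNorm_zigzag_zero_le n m).1]

theorem asymptotics_valley : ∃ K v : ℝ, |K - (0.728207 : ℚ)| < (0.0000005 : ℚ) ∧
    |v - (1.84092 : ℚ)| < (0.000005 : ℚ) ∧
    (fun n : ℕ => (compCount valley n 0 : ℝ) - K * v ^ n) =O[atTop]
      fun n : ℕ => (10 / 7 : ℝ) ^ n := by
  refine isBigO_of_certificate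
    ((isStable_zigzag_fst (-1)).stableLim_mul_avoidGF (isStable_zigzag_fst 0) zigzag_valley_mul)
    ((isStable_zigzag_fst (-1)).rep_stableLim (rep_zigzag (rep_neg_one 100) 100).1)
    ((isStable_zigzag_fst 0).rep_stableLim (rep_zigzag (rep_zero 100) 100).1)
    (CoeffBound.stableLim fun n m => ?_) (CoeffBound.stableLim fun n m => ?_) certificate_valley
  · have h0 : partialNorm (17 / 20) n (-1) ≤ 1 := by
      rw [partialNorm_neg]
      exact partialNorm_one_le n
    have h := (partialNorm_zigzag_le (R := 17 / 20) (by norm_num) n m h0).1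
    linarith [growth_le m]
  · linarith [(partialNorm_zigzag_zero_le n m).1]

end CompPattern

theorem theorem5 :
    (∃ K v : ℝ, |K - 0.499301| < 0.0000005 ∧ |v - 1.91076| < 0.000005 ∧
      (fun n : ℕ => (CompPattern.compCount CompPattern.pat111 n 0 : ℝ) - K * v ^ n)
        =O[atTop] fun n : ℕ => (10 / 7 : ℝ) ^ n) ∧
    (∃ K v : ℝ, |K - 0.692005| < 0.0000005 ∧ |v - 1.80688| < 0.000005 ∧
      (fun n : ℕ => (CompPattern.compCount CompPattern.pat112 n 0 : ℝ) - K * v ^ n)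
        =O[atTop] fun n : ℕ => (10 / 7 : ℝ) ^ n) ∧
    (∃ K v : ℝ, |K - 0.545362| < 0.0000005 ∧ |v - 1.94785| < 0.000005 ∧
      (fun n : ℕ => (CompPattern.compCount CompPattern.pat221 n 0 : ℝ) - K * v ^ n)
        =O[atTop] fun n : ℕ => (10 / 7 : ℝ) ^ n) ∧
    (∃ K v : ℝ, |K - 0.576096| < 0.0000005 ∧ |v - 1.94823| < 0.000005 ∧
      (fun n : ℕ => (CompPattern.compCount CompPattern.pat123 n 0 : ℝ) - K * v ^ n)
        =O[atTop] fun n : ℕ => (10 / 7 : ℝ) ^ n) ∧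
    (∃ K v : ℝ, |K - 1.39456| < 0.000005 ∧ |v - 1.62975| < 0.000005 ∧
      (fun n : ℕ => (CompPattern.compCount CompPattern.peak n 0 : ℝ) - K * v ^ n)
        =O[atTop] fun n : ℕ => (10 / 7 : ℝ) ^ n) ∧
    (∃ K v : ℝ, |K - 0.728207| < 0.0000005 ∧ |v - 1.84092| < 0.000005 ∧
      (fun n : ℕ => (CompPattern.compCount CompPattern.valley n 0 : ℝ) - K * v ^ n)
        =O[atTop] fun n : ℕ => (10 / 7 : ℝ) ^ n) := by
  refine ⟨?_, ?_, ?_, ?_, ?_, ?_⟩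
  · simpa using CompPattern.asymptotics_pat111
  · simpa using CompPattern.asymptotics_pat112
  · simpa using CompPattern.asymptotics_pat221
  · simpa using CompPattern.asymptotics_pat123
  · simpa using CompPattern.asymptotics_peak
  · simpa using CompPattern.asymptotics_valley
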